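/- An extraspecial commutative Frobenius monoid in a symmetric monoidal category $(\mathcal C,\otimes,I)$ is an object $X$ with a commutative monoid structure $(\mu\colon X\otimes X\to X,\ \eta\colon I\to X)$ and a cocommutative comonoid structure $(\delta\colon X\to X\otimes X,\ \epsilon\colon X\to I)$ satisfying the Frobenius law $(\mathrm{id}\otimes\mu)\circ(\delta\otimes\mathrm{id})=\delta\circ\mu=(\mu\otimes\mathrm{id})\circ(\mathrm{id}\otimes\delta)$, the special law $\mu\circ\delta=\mathrm{id}_X$ and the extra law $\epsilon\circ\eta=\mathrm{id}_I$. Consider the formal terms $n\to m$ $(n,m\in\mathbb N)$ built by composition $\circ$ and monoidal product $+$ from the generators $\mu\colon 2\to 1$, $\eta\colon 0\to 1$, $\delta\colon 1\to 2$, $\epsilon\colon 1\to 0$, the empty term $\varnothing\colon 0\to 0$, the identity $1\to 1$ and the braiding $2\to 2$. Let $\mathbf{Th(ESCFM)}$ be the prop presented by these generators and the equations of an extraspecial commutative Frobenius monoid: its morphisms $n\to m$ are the terms $n\to m$ modulo the smallest congruence that contains these equations and the laws of a symmetric strict monoidal category with objects the natural numbers and monoidal product addition. A corelation $X\to Y$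 between finite sets is a partition of the disjoint union $X+Y$. The composite of $\alpha\colon X\to Y$ and $\beta\colon Y\to Z$ is the restriction to $X+Z$ of the finest partition of $X+Y+Z$ whose restrictions to $X+Y$ and to $Y+Z$ are coarser than $\alpha$ and $\beta$ respectively; the monoidal product of corelations is disjoint union. Every term $t\colon n\to m$ is assigned a corelation from an $n$-element set to an $m$-element set: each of $\mu,\eta,\delta,\epsilon$ goes to the partition with a single block, the empty term, the identity and the braiding go to the empty, identity and braiding corelations, and $\circ$, $+$ go to composition and monoidal product of corelations. Theorem (spider theorem). Let $s,t\colon n\to m$ be two such terms. Then $s$ and $t$ denote the same morphism of $\mathbf{Th(ESCFM)}$ if and only if they are assigned the same corelation, that is, if and only if they induce the same connectivity on the disjoint union of domain and codomain. Moreover, if they are assigned the same corelation, then for every extraspecial commutative Frobenius monoid $X$ in every symmetric monoidal category, $s$ and $t$ denote the same morphism $X^{\otimes n}\to X^{\otimes m}$. -/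

import Mathlib

/-! ### Terms of a symmetric monoidal theory -/

/-- A signature: a type of formal generators `σ : n ⟶ m` for all natural numbers `n`, `m`. -/
abbrev PropSignature : Type 1 := ℕ → ℕ → Type

/-- Terms over a signature. `comp a b` is the composite `b ∘ a` (first `a`, then `b`), and
`tensor a c` is the monoidal product `a + c`. -/
inductive PropTerm (S : PropSignature) : ℕ → ℕ → Type
  | empty : PropTerm S 0 0
  | one : PropTerm S 1 1
  | swap : PropTerm S 2 2
  | gen {n m : ℕ} (g : S n m) : PropTerm S n m
  | comp {n m p : ℕ} (a : PropTerm S n m) (b : PropTerm S m p) : PropTerm S n p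
  | tensor {n m p q : ℕ} (a : PropTerm S n m) (c : PropTerm S p q) : PropTerm S (n + p) (m + q)

namespace PropTerm

/-- Transport of a term along equalities of its domain and codomain. -/
def cast {S : PropSignature} {n m n' m' : ℕ} (hn : n = n') (hm : m = m')
    (t : PropTerm S n m) : PropTerm S n' m' :=
  hn ▸ hm ▸ t

/-- The identity on `n`: the monoidal product of `n` copies of the unit `1 ⟶ 1`. -/
def idn (S : PropSignature) : (n : ℕ) → PropTerm S n n
  | 0 => empty
  | n + 1 => tensor (idn S n) one

/-- The braiding `1 + m ⟶ m + 1` that moves one wire past `m` wires. -/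
def braidOne (S : PropSignature) : (m : ℕ) → PropTerm S (1 + m) (m + 1)
  | 0 => one
  | m + 1 => comp (tensor (n := 1 + m) (p := 1) (q := 1) (braidOne S m) one)
      (tensor (n := m) (m := m) (p := 2) (q := 2) (idn S m) swap)

/-- The block braiding `n + m ⟶ m + n`, built from `swap : 2 ⟶ 2`
by the hexagon identities. -/
def braid (S : PropSignature) : (n m : ℕ) → PropTerm S (n + m) (m + n)
  | 0, m => (idn S m).cast (Nat.zero_add m).symm rfl
  | n + 1, m =>
      comp ((tensor (idn S n) (braidOne S m)).cast
          ((Nat.add_assoc n 1 m).symm) (Nat.add_assoc n m 1).symm)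
        (tensor (n := n + m) (m := m + n) (p := 1) (q := 1) (braid S n m) one)

end PropTerm

/-- A symmetric monoidal theory: a signature together with a set of equations, which are pairs
of terms of the same type. -/
structure PropTheory where
  /-- the generators -/
  sig : PropSignature
  /-- `eqn s t` says that `s = t` is one of the equations -/
  eqn : ∀ {n m : ℕ}, PropTerm sig n m → PropTerm sig n m → Prop

open PropTerm in
/-- Equality of terms in the prop presented by a theory: the smallest equivalence relation on
terms which is compatible with composition and monoidal product, satisfies the laws of a
symmetric strict monoidal category with objects the natural numbers and monoidal product
addition, and contains the equations of the theory. -/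
inductive PropTheory.Rel (T : PropTheory) :
    ∀ {n m : ℕ}, PropTerm T.sig n m → PropTerm T.sig n m → Prop
  | refl {n m : ℕ} (a : PropTerm T.sig n m) : Rel T a a
  | symm {n m : ℕ} {a b : PropTerm T.sig n m} : Rel T a b → Rel T b a
  | trans {n m : ℕ} {a b c : PropTerm T.sig n m} : Rel T a b → Rel T b c → Rel T a c
  | comp_congr {n m p : ℕ} {a a' : PropTerm T.sig n m} {b b' : PropTerm T.sig m p} :
      Rel T a a' → Rel T b b' → Rel T (comp a b) (comp a' b')
  | tensor_congr {n m p q : ℕ} {a a' : PropTerm T.sig n m} {c c' : PropTerm T.sig p q} :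
      Rel T a a' → Rel T c c' → Rel T (tensor a c) (tensor a' c')
  -- the laws of a category
  | id_comp {n m : ℕ} (a : PropTerm T.sig n m) : Rel T (comp (idn T.sig n) a) a
  | comp_id {n m : ℕ} (a : PropTerm T.sig n m) : Rel T (comp a (idn T.sig m)) a
  | comp_assoc {n m p q : ℕ} (a : PropTerm T.sig n m) (b : PropTerm T.sig m p)
      (c : PropTerm T.sig p q) : Rel T (comp (comp a b) c) (comp a (comp b c))
  -- the monoidal product is a functor
  | tensor_id (n m : ℕ) : Rel T (tensor (idn T.sig n) (idn T.sig m)) (idn T.sig (n + m))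
  | interchange {n m p n' m' p' : ℕ} (a : PropTerm T.sig n m) (b : PropTerm T.sig m p)
      (a' : PropTerm T.sig n' m') (b' : PropTerm T.sig m' p') :
      Rel T (tensor (comp a b) (comp a' b')) (comp (tensor a a') (tensor b b'))
  -- the monoidal product is strictly unital and associative
  | empty_tensor {n m : ℕ} (a : PropTerm T.sig n m) :
      Rel T (tensor empty a) (a.cast (Nat.zero_add n).symm (Nat.zero_add m).symm)
  | tensor_empty {n m : ℕ} (a : PropTerm T.sig n m) : Rel T (tensor a empty) a
  | tensor_assoc {n m n' m' n'' m'' : ℕ} (a : PropTerm T.sig n m) (b : PropTerm T.sig n' m')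
      (c : PropTerm T.sig n'' m'') :
      Rel T (tensor (tensor a b) c)
        ((tensor a (tensor b c)).cast (Nat.add_assoc n n' n'').symm (Nat.add_assoc m m' m'').symm)
  -- the braiding is natural and symmetric
  | braid_natural {n m p q : ℕ} (a : PropTerm T.sig n m) (c : PropTerm T.sig p q) :
      Rel T (comp (tensor a c) (braid T.sig m q)) (comp (braid T.sig n p) (tensor c a))
  | braid_symm (n m : ℕ) :
      Rel T (comp (braid T.sig n m) (braid T.sig m n)) (idn T.sig (n + m))
  -- the equations of the theory
  | eqn {n m : ℕ} {s t : PropTerm T.sig n m} : T.eqn s t → Rel T s t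

/-- The morphisms `n ⟶ m` of the prop presented by a theory `T`: terms modulo equality. -/
def PropTheory.Hom (T : PropTheory) (n m : ℕ) : Type :=
  Quotient (⟨T.Rel, ⟨.refl, .symm, .trans⟩⟩ : Setoid (PropTerm T.sig n m))

/-- The morphism of the prop presented by `T` that a term denotes. -/
def PropTheory.toHom (T : PropTheory) {n m : ℕ} (t : PropTerm T.sig n m) : T.Hom n m :=
  Quotient.mk _ t

/-! ### The theory of extraspecial commutative Frobenius monoids -/

/-- The generators: multiplication, unit, comultiplication, counit. -/
inductive EscfmGen : ℕ → ℕ → Type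
  | mul : EscfmGen 2 1
  | unit : EscfmGen 0 1
  | comul : EscfmGen 1 2
  | counit : EscfmGen 1 0

open PropTerm EscfmGen in
/-- The equations of extraspecial commutative Frobenius monoids. -/
inductive EscfmEqn : ∀ {n m : ℕ}, PropTerm EscfmGen n m → PropTerm EscfmGen n m → Prop
  | assoc : EscfmEqn (comp (tensor (gen mul) one) (gen mul))
      (comp (tensor (n := 1) (p := 2) one (gen mul)) (gen mul))
  | unital : EscfmEqn (comp (tensor (gen unit) one) (gen mul)) one
  | comm : EscfmEqn (comp swap (gen mul)) (gen mul)
  | coassoc : EscfmEqn (comp (gen comul) (tensor (gen comul) one))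
      (comp (gen comul) (tensor one (gen comul)))
  | counital : EscfmEqn (comp (gen comul) (tensor (gen counit) one)) one
  | cocomm : EscfmEqn (comp (gen comul) swap) (gen comul)
  | frobenius_left : EscfmEqn (comp (tensor (gen comul) one) (tensor (n := 1) (p := 2) one (gen mul)))
      (comp (gen mul) (gen comul))
  | frobenius_right : EscfmEqn (comp (gen mul) (gen comul))
      (comp (tensor one (gen comul)) (tensor (gen mul) one))
  | special : EscfmEqn (comp (gen comul) (gen mul)) one
  | extra : EscfmEqn (comp (gen unit) (gen counit)) empty

/-- The theory of extraspecial commutative Frobenius monoids. -/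
def escfmTheory : PropTheory where
  sig := EscfmGen
  eqn := EscfmEqn

/-- Terms built from the generators of an extraspecial commutative Frobenius monoid. -/
abbrev EscfmTerm (n m : ℕ) : Type := PropTerm escfmTheory.sig n m

/-! ### Corelations -/

/-- A corelation from `X` to `Y`: a partition (an equivalence relation) of `X + Y`. -/
abbrev Corelation (X Y : Type) : Type := Setoid (X ⊕ Y)

namespace Corelation

/-- The identity corelation: the blocks are the pairs of the two copies of an element. -/
@[reducible] def id (X : Type) : Corelation X X :=
  Setoid.ker (Sum.elim (fun x => x) (fun x => x))

/-- The composite of `α : X ⟶ Y` and `β : Y ⟶ Z`: the restriction to `X + Z` of the finest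
partition of `X + Y + Z` whose restrictions to `X + Y` and `Y + Z` are coarser than `α` and `β`.
(In the order of `Setoid`, `r ≤ s` means that `s` is coarser than `r`.) -/
@[reducible] def comp {X Y Z : Type} (α : Corelation X Y) (β : Corelation Y Z) : Corelation X Z :=
  (sInf {r : Setoid (X ⊕ (Y ⊕ Z)) |
      α ≤ r.comap (Sum.elim Sum.inl (Sum.inr ∘ Sum.inl)) ∧ β ≤ r.comap Sum.inr}).comap
    (Sum.elim Sum.inl (Sum.inr ∘ Sum.inr))

/-- The monoidal product (disjoint union) of two corelations: two elements are in the same block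
if both belong to `X + Y` and are in the same block of `α`, or both belong to `X' + Y'` and are
in the same block of `β`. -/
@[reducible] def sum {X Y X' Y' : Type} (α : Corelation X Y) (β : Corelation X' Y') :
    Corelation (X ⊕ X') (Y ⊕ Y') :=
  Setoid.ker (Sum.elim
    (Sum.map (fun x => Quotient.mk α (Sum.inl x)) (fun x' => Quotient.mk β (Sum.inl x')))
    (Sum.map (fun y => Quotient.mk α (Sum.inr y)) (fun y' => Quotient.mk β (Sum.inr y'))))

/-- The monoidal product on the skeleton, with `Fin (n + p)` as the disjoint union
of `Fin n` and `Fin p`. -/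
@[reducible] def finSum {n m p q : ℕ} (α : Corelation (Fin n) (Fin m)) (β : Corelation (Fin p) (Fin q)) :
    Corelation (Fin (n + p)) (Fin (m + q)) :=
  (sum α β).comap (Sum.map finSumFinEquiv.symm finSumFinEquiv.symm)

/-- The braiding `2 ⟶ 2`: the input `0` is connected to the output `1` and vice versa. -/
@[reducible] def swap : Corelation (Fin 2) (Fin 2) :=
  Setoid.ker (Sum.elim (fun i => i) Fin.rev)

end Corelation

/-- The corelation of a term. Each generator is sent to the corelation with a single block, the
remaining term formers to the corresponding structure of the category of corelations. -/
@[reducible] def EscfmTerm.corelation : {n m : ℕ} → EscfmTerm n m → Corelation (Fin n) (Fin m)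
  | _, _, .empty => Corelation.id (Fin 0)
  | _, _, .one => Corelation.id (Fin 1)
  | _, _, .swap => Corelation.swap
  | _, _, .gen _ => ⊤
  | _, _, .comp a b => Corelation.comp (corelation a) (corelation b)
  | _, _, .tensor a c => Corelation.finSum (corelation a) (corelation c)

/-! ### Extraspecial commutative Frobenius monoids in symmetric monoidal categories -/

open CategoryTheory MonoidalCategory

universe v u

/-- An extraspecial commutative Frobenius monoid in a symmetric monoidal category. -/
class ExtraspecialFrobenius {C : Type u} [Category.{v} C] [MonoidalCategory C]
    [SymmetricCategory C] (X : C) extends MonObj X, ComonObj X where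
  mul_comm : (β_ X X).hom ≫ mul = mul
  comul_comm : comul ≫ (β_ X X).hom = comul
  frobenius_left : comul ▷ X ≫ (α_ X X X).hom ≫ X ◁ mul = mul ≫ comul
  frobenius_right : mul ≫ comul = X ◁ comul ≫ (α_ X X X).inv ≫ mul ▷ X
  special : comul ≫ mul = 𝟙 X
  extra : one ≫ counit = 𝟙 (𝟙_ C)

section Interpretation

variable {C : Type u} [Category.{v} C] [MonoidalCategory C]

/-- The tensor power `(((I ⊗ X) ⊗ X) ⊗ ⋯) ⊗ X` with `n` factors `X`. -/
def tensorPow (X : C) : ℕ → C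
  | 0 => 𝟙_ C
  | n + 1 => tensorPow X n ⊗ X

/-- The canonical isomorphism between a product of two tensor powers and a tensor power. -/
def tensorPowAdd (X : C) (n : ℕ) : (p : ℕ) → (tensorPow X n ⊗ tensorPow X p ≅ tensorPow X (n + p))
  | 0 => ρ_ (tensorPow X n)
  | p + 1 => (α_ (tensorPow X n) (tensorPow X p) X).symm ≪≫
      whiskerRightIso (tensorPowAdd X n p) X

/-- The canonical isomorphism between the first tensor power of `X` and `X`. -/
def tensorPowOne (X : C) : tensorPow X 1 ≅ X := λ_ X

/-- The canonical isomorphism between the second tensor power of `X` and `X ⊗ X`. -/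
def tensorPowTwo (X : C) : tensorPow X 2 ≅ X ⊗ X := whiskerRightIso (λ_ X) X

variable [SymmetricCategory C]

/-- The structure morphism that interprets a generator in an extraspecial commutative
Frobenius monoid. -/
def EscfmGen.interp (X : C) [ExtraspecialFrobenius X] :
    {n m : ℕ} → EscfmGen n m → (tensorPow X n ⟶ tensorPow X m)
  | _, _, .mul => (tensorPowTwo X).hom ≫ (MonObj.mul : X ⊗ X ⟶ X) ≫ (tensorPowOne X).inv
  | _, _, .unit => (MonObj.one : 𝟙_ C ⟶ X) ≫ (tensorPowOne X).inv
  | _, _, .comul => (tensorPowOne X).hom ≫ (ComonObj.comul : X ⟶ X ⊗ X) ≫ (tensorPowTwo X).inv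
  | _, _, .counit => (tensorPowOne X).hom ≫ (ComonObj.counit : X ⟶ 𝟙_ C)

/-- The morphism between tensor powers of an extraspecial commutative Frobenius monoid that a
term denotes. -/
def EscfmTerm.interp (X : C) [ExtraspecialFrobenius X] :
    {n m : ℕ} → EscfmTerm n m → (tensorPow X n ⟶ tensorPow X m)
  | _, _, .empty => 𝟙 (tensorPow X 0)
  | _, _, .one => 𝟙 (tensorPow X 1)
  | _, _, .swap => (tensorPowTwo X).hom ≫ (β_ X X).hom ≫ (tensorPowTwo X).inv
  | _, _, .gen g => EscfmGen.interp X g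
  | _, _, .comp a b => interp X a ≫ interp X b
  | _, _, .tensor (n := n) (m := m) (p := p) (q := q) a c =>
      (tensorPowAdd X n p).inv ≫ (interp X a ⊗ₘ interp X c) ≫ (tensorPowAdd X m q).hom

end Interpretation

/-! Labelling wires by Booleans sends every term to a relation between Boolean vectors. This
respects all laws of the prop (`EscfmTerm.labels_congr`), and the related pairs are exactly the
labellings constant on the blocks of the corelation of the term (`EscfmTerm.compat_corelation`).
Indicator functions of blocks are such labellings, so equal corelations mean equal label relations
(`EscfmTerm.corelation_eq_iff`). It remains to show that the label relation determines the morphism.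

Bending inputs to outputs with the self-duality given by `cup` and `cap` reduces this to states `0 ⟶
n` (`addWire_cap_injective`). A state is normal if it is built wire by wire, each wire being either
fresh (a unit) or a copy of an earlier one. Every term is a composite of a few operations at the
last wires and of adjacent swaps (`IsLayered.ofTerm`). All of these preserve normality, so every
state is normal (`isNormal`); the essential case is a cap, which connects two wires
(`IsNormal.comp_connect`).

Two normal states with the same labellings agree by induction: the labels tell whether the last wire
is fresh or a copy, and copying either of two connected wires gives the same result
(`IsNormal.comp_copy_eq`).

For the last claim, interpretation in a symmetric monoidal category is sound for the congruence
(`EscfmTerm.interp_congr`): the coherence isomorphisms between tensor powers account for strictness.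
-/

/-! ### The prop as a category, and its monoidal product. -/

/-- The objects of the prop of extraspecial commutative Frobenius monoids. -/
structure EscfmObj where
  /-- the number of wires -/
  wires : ℕ

namespace EscfmObj

open PropTerm

/-- Composition in the prop. -/
def homComp {n m p : ℕ} : escfmTheory.Hom n m → escfmTheory.Hom m p → escfmTheory.Hom n p :=
  Quotient.map₂ PropTerm.comp fun _ _ h _ _ h' => .comp_congr h h'

instance : Category EscfmObj where
  Hom a b := escfmTheory.Hom a.wires b.wires
  id a := escfmTheory.toHom (idn _ a.wires)
  comp f g := homComp f g
  id_comp f := Quotient.inductionOn f fun a => Quotient.sound (.id_comp a)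
  comp_id f := Quotient.inductionOn f fun a => Quotient.sound (.comp_id a)
  assoc f g h := Quotient.inductionOn₃ f g h fun a b c => Quotient.sound (.comp_assoc a b c)

/-- The morphism denoted by a term. -/
def ofTerm {n m : ℕ} (t : EscfmTerm n m) : mk n ⟶ mk m := escfmTheory.toHom t

/-- The monoidal product of morphisms of the prop. -/
def tens {n m p q : ℕ} (f : mk n ⟶ mk m) (g : mk p ⟶ mk q) : mk (n + p) ⟶ mk (m + q) :=
  Quotient.map₂ PropTerm.tensor (fun _ _ h _ _ h' => .tensor_congr h h') f g

theorem ofTerm_surjective {n m : ℕ} (f : mk n ⟶ mk m) : ∃ t : EscfmTerm n m, ofTerm t = f :=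
  Quotient.exists_rep f

theorem ofTerm_eq {n m : ℕ} {s t : EscfmTerm n m} (h : escfmTheory.Rel s t) :
    ofTerm s = ofTerm t := Quotient.sound h

theorem ofTerm_comp {n m p : ℕ} (s : EscfmTerm n m) (t : EscfmTerm m p) :
    ofTerm (.comp s t) = ofTerm s ≫ ofTerm t := rfl

theorem ofTerm_tensor {n m p q : ℕ} (s : EscfmTerm n m) (t : EscfmTerm p q) :
    ofTerm (.tensor s t) = tens (ofTerm s) (ofTerm t) := rfl

theorem ofTerm_empty : ofTerm .empty = 𝟙 (mk 0) := rfl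

theorem tens_id (n m : ℕ) : tens (𝟙 (mk n)) (𝟙 (mk m)) = 𝟙 (mk (n + m)) :=
  Quotient.sound (.tensor_id n m)

theorem tens_comp {n m p n' m' p' : ℕ} (a : mk n ⟶ mk m) (b : mk m ⟶ mk p)
    (a' : mk n' ⟶ mk m') (b' : mk m' ⟶ mk p') :
    tens (a ≫ b) (a' ≫ b') = tens a a' ≫ tens b b' := by
  obtain ⟨a, rfl⟩ := ofTerm_surjective a
  obtain ⟨b, rfl⟩ := ofTerm_surjective b
  obtain ⟨a', rfl⟩ := ofTerm_surjective a'
  obtain ⟨b', rfl⟩ := ofTerm_surjective b'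
  exact Quotient.sound (.interchange a b a' b')

/-- The identity on `1` is by definition `empty + one`, so this is left unitality. -/
theorem ofTerm_one : ofTerm .one = 𝟙 (mk 1) :=
  (ofTerm_eq (.empty_tensor (T := escfmTheory) .one)).symm

/-- Adding one wire on the right. -/
def addWire {n m : ℕ} (f : mk n ⟶ mk m) : mk (n + 1) ⟶ mk (m + 1) := tens f (𝟙 (mk 1))

theorem addWire_id (n : ℕ) : addWire (𝟙 (mk n)) = 𝟙 (mk (n + 1)) := tens_id n 1

theorem addWire_comp {n m p : ℕ} (f : mk n ⟶ mk m) (g : mk m ⟶ mk p) :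
    addWire (f ≫ g) = addWire f ≫ addWire g := by
  rw [addWire, ← Category.comp_id (𝟙 (mk 1)), tens_comp]; simp [addWire]

/-- Since `(n + p) + 1` and `n + (p + 1)` agree definitionally, this instance of associativity needs
no cast. This is why operations are placed at the last wires and spare wires are added on the right.
-/
theorem addWire_tens {n m p q : ℕ} (f : mk n ⟶ mk m) (g : mk p ⟶ mk q) :
    addWire (tens f g) = tens f (addWire g) := by
  obtain ⟨a, rfl⟩ := ofTerm_surjective f
  obtain ⟨b, rfl⟩ := ofTerm_surjective g
  rw [addWire, addWire, ← ofTerm_one]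
  exact Quotient.sound (.tensor_assoc a b .one)

/-- Adding `n` wires on the left. -/
def addLeft (n : ℕ) {k l : ℕ} (g : mk k ⟶ mk l) : mk (n + k) ⟶ mk (n + l) := tens (𝟙 (mk n)) g

theorem addLeft_id (n k : ℕ) : addLeft n (𝟙 (mk k)) = 𝟙 (mk (n + k)) := tens_id n k

theorem addLeft_comp (n : ℕ) {k l p : ℕ} (f : mk k ⟶ mk l) (g : mk l ⟶ mk p) :
    addLeft n (f ≫ g) = addLeft n f ≫ addLeft n g := by
  rw [addLeft, ← Category.comp_id (𝟙 (mk n)), tens_comp]; simp [addLeft]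

theorem addWire_addLeft (n : ℕ) {k l : ℕ} (g : mk k ⟶ mk l) :
    addWire (addLeft n g) = addLeft n (addWire g) := addWire_tens _ _

theorem tens_eq {n m p q : ℕ} (f : mk n ⟶ mk m) (g : mk p ⟶ mk q) :
    tens f g = tens f (𝟙 _) ≫ addLeft m g := by
  rw [addLeft, ← tens_comp]; simp

theorem tens_eq' {n m p q : ℕ} (f : mk n ⟶ mk m) (g : mk p ⟶ mk q) :
    tens f g = addLeft n g ≫ tens f (𝟙 _) := by
  rw [addLeft, ← tens_comp]; simp

theorem tens_id_zero {n m : ℕ} (f : mk n ⟶ mk m) : tens f (𝟙 (mk 0)) = f := by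
  obtain ⟨a, rfl⟩ := ofTerm_surjective f
  exact Quotient.sound (.tensor_empty a)

theorem tens_id_succ {n m : ℕ} (f : mk n ⟶ mk m) (k : ℕ) :
    tens f (𝟙 (mk (k + 1))) = addWire (tens f (𝟙 (mk k))) := by
  rw [addWire_tens, addWire_id]

/-! ### The structure maps at the last wires and their equations. -/

/-- The multiplication of the last two wires. -/
def mu (n : ℕ) : mk (n + 2) ⟶ mk (n + 1) := addLeft n (ofTerm (.gen .mul))
/-- A new wire at the end. -/
def un (n : ℕ) : mk n ⟶ mk (n + 1) := addLeft n (ofTerm (.gen .unit))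
/-- The comultiplication of the last wire. -/
def co (n : ℕ) : mk (n + 1) ⟶ mk (n + 2) := addLeft n (ofTerm (.gen .comul))
/-- The counit at the last wire. -/
def ep (n : ℕ) : mk (n + 1) ⟶ mk n := addLeft n (ofTerm (.gen .counit))
/-- The braiding of the last two wires. -/
def sw (n : ℕ) : mk (n + 2) ⟶ mk (n + 2) := addLeft n (ofTerm .swap)

/-- Interchange: the two orders of performing `f` and the unit in their product. The other
naturality lemmas arise in the same way. -/
theorem naturality_un {n m : ℕ} (f : mk n ⟶ mk m) : un n ≫ addWire f = f ≫ un m := by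
  have h := (tens_eq' f (ofTerm (.gen .unit))).symm.trans (tens_eq _ _)
  rwa [tens_id_zero] at h

theorem naturality_ep {n m : ℕ} (f : mk n ⟶ mk m) : addWire f ≫ ep m = ep n ≫ f := by
  have h := (tens_eq' f (ofTerm (.gen .counit))).symm.trans (tens_eq _ _)
  rw [tens_id_zero] at h
  exact h.symm

theorem naturality_co {n m : ℕ} (f : mk n ⟶ mk m) :
    co n ≫ addWire (addWire f) = addWire f ≫ co m := by
  have h := (tens_eq' f (ofTerm (.gen .comul))).symm.trans (tens_eq _ _)
  rwa [tens_id_succ] at h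

theorem naturality_mu {n m : ℕ} (f : mk n ⟶ mk m) :
    mu n ≫ addWire f = addWire (addWire f) ≫ mu m := by
  have h := (tens_eq' f (ofTerm (.gen .mul))).symm.trans (tens_eq _ _)
  rwa [tens_id_succ f 1] at h

theorem naturality_sw {n m : ℕ} (f : mk n ⟶ mk m) :
    sw n ≫ addWire (addWire f) = addWire (addWire f) ≫ sw m := by
  have h := (tens_eq' f (ofTerm .swap)).symm.trans (tens_eq _ _)
  rwa [tens_id_succ f 1] at h

/-- One of the spare wires is absorbed into the local term, so that equations between terms on up to
three wires apply behind `n` further wires. -/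
theorem mu_succ (n : ℕ) : mu (n + 1) = addLeft n (ofTerm (.tensor (p := 2) .one (.gen .mul))) :=
  Quotient.sound (.tensor_assoc (T := escfmTheory) (idn _ n) .one (.gen .mul))
theorem un_succ (n : ℕ) : un (n + 1) = addLeft n (ofTerm (.tensor .one (.gen .unit))) :=
  Quotient.sound (.tensor_assoc (T := escfmTheory) (idn _ n) .one (.gen .unit))
theorem co_succ (n : ℕ) : co (n + 1) = addLeft n (ofTerm (.tensor (q := 2) .one (.gen .comul))) :=
  Quotient.sound (.tensor_assoc (T := escfmTheory) (idn _ n) .one (.gen .comul))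
theorem ep_succ (n : ℕ) : ep (n + 1) = addLeft n (ofTerm (.tensor .one (.gen .counit))) :=
  Quotient.sound (.tensor_assoc (T := escfmTheory) (idn _ n) .one (.gen .counit))
theorem sw_succ (n : ℕ) :
    sw (n + 1) = addLeft n (ofTerm (.tensor (p := 2) (q := 2) .one .swap)) :=
  Quotient.sound (.tensor_assoc (T := escfmTheory) (idn _ n) .one .swap)

theorem addWire_addLeft_ofTerm (n : ℕ) {k l : ℕ} (t : EscfmTerm k l) :
    addWire (addLeft n (ofTerm t)) = addLeft n (ofTerm (.tensor t .one)) := by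
  rw [addWire_addLeft, addWire, ← ofTerm_one]; rfl

theorem braidOne_one : ofTerm (braidOne _ 1) = ofTerm .swap := by
  have h1 : ofTerm (.tensor .one .one) = 𝟙 (mk 2) := by
    rw [ofTerm_tensor, ofTerm_one, tens_id]
  have h2 : ofTerm (.tensor (n := 0) (m := 0) (p := 2) (q := 2) .empty .swap) = ofTerm .swap :=
    ofTerm_eq (.empty_tensor (T := escfmTheory) .swap)
  calc ofTerm (braidOne _ 1) = ofTerm (.tensor .one .one) ≫
        ofTerm (.tensor (n := 0) (m := 0) (p := 2) (q := 2) .empty .swap) := rfl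
    _ = _ := by rw [h1, h2, Category.id_comp]

theorem braid_one_zero : ofTerm (braid _ 1 0) = 𝟙 (mk 1) := by
  have h1 : ofTerm (.tensor .empty .one) = 𝟙 (mk 1) := by
    rw [ofTerm_tensor, ofTerm_one]; exact tens_id 0 1
  calc ofTerm (braid _ 1 0) = ofTerm (.tensor .empty .one) ≫ ofTerm (.tensor .empty .one) := rfl
    _ = _ := by rw [h1, Category.comp_id]


/-- Naturality and symmetry are imposed on the recursively defined block braiding; the small cases
translate them into statements about `swap`. -/
theorem braid_one_one : ofTerm (braid _ 1 1) = ofTerm .swap := by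
  have h1 : ofTerm (.tensor (n := 1) (m := 1) (idn _ 1) .one) = 𝟙 (mk 2) := by
    rw [ofTerm_tensor, ofTerm_one]; exact tens_id 1 1
  calc ofTerm (braid _ 1 1) = ofTerm (.tensor (n := 0) (m := 0) (p := 2) (q := 2) .empty
        (braidOne _ 1)) ≫ ofTerm (.tensor (n := 1) (m := 1) (idn _ 1) .one) := rfl
    _ = ofTerm (braidOne _ 1) ≫ 𝟙 (mk 2) :=
        congr_arg₂ (fun (f g : mk 2 ⟶ mk 2) => f ≫ g)
          (ofTerm_eq (.empty_tensor (T := escfmTheory) (n := 2) (m := 2) (braidOne _ 1))) h1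
    _ = _ := by rw [Category.comp_id, braidOne_one]

theorem addWire_ofTerm {k l : ℕ} (t : EscfmTerm k l) :
    addWire (ofTerm t) = ofTerm (.tensor t .one) := by
  rw [addWire, ← ofTerm_one]; rfl

theorem ofTerm_idn_one_tensor {k l : ℕ} (t : EscfmTerm k l) :
    ofTerm (.tensor (idn _ 1) t) = ofTerm (.tensor .one t) := by
  rw [ofTerm_tensor, ofTerm_tensor, ofTerm_one]; rfl

theorem braid_one_two : ofTerm (braid _ 1 2) =
    ofTerm (.tensor (n := 2) (m := 2) .swap .one) ≫ ofTerm (.tensor (p := 2) (q := 2) .one .swap) := by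
  have h1 : ofTerm (.tensor (n := 2) (m := 2) (idn _ 2) .one) = 𝟙 (mk 3) := by
    rw [ofTerm_tensor, ofTerm_one]; exact tens_id 2 1
  calc ofTerm (braid _ 1 2) = ofTerm (.tensor (n := 0) (m := 0) (p := 3) (q := 3) .empty
        (braidOne _ 2)) ≫ ofTerm (.tensor (n := 2) (m := 2) (idn _ 2) .one) := rfl
    _ = ofTerm (braidOne _ 2) ≫ 𝟙 (mk 3) :=
        congr_arg₂ (fun (f g : mk 3 ⟶ mk 3) => f ≫ g)
          (ofTerm_eq (.empty_tensor (T := escfmTheory) (braidOne _ 2))) h1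
    _ = ofTerm (.tensor (n := 2) (m := 2) (braidOne _ 1) .one) ≫
          ofTerm (.tensor (p := 2) (q := 2) (idn _ 1) .swap) := by
        rw [Category.comp_id]; rfl
    _ = _ := congr_arg₂ (fun (f g : mk 3 ⟶ mk 3) => f ≫ g)
        ((addWire_ofTerm (k := 2) (l := 2) _).symm.trans
          ((congrArg addWire braidOne_one).trans (addWire_ofTerm _)))
        (ofTerm_idn_one_tensor .swap)

theorem braid_two_one : ofTerm (braid _ 2 1) =
    ofTerm (.tensor (p := 2) (q := 2) .one .swap) ≫ ofTerm (.tensor (n := 2) (m := 2) .swap .one) := by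
  calc ofTerm (braid _ 2 1) = ofTerm (.tensor (n := 1) (m := 1) (p := 2) (q := 2) (idn _ 1)
        (braidOne _ 1)) ≫ ofTerm (.tensor (n := 2) (m := 2) (braid _ 1 1) .one) := rfl
    _ = _ := congr_arg₂ (fun (f g : mk 3 ⟶ mk 3) => f ≫ g)
        ((ofTerm_idn_one_tensor (k := 2) (l := 2) (braidOne _ 1)).trans
          (congrArg (tens (ofTerm .one)) braidOne_one))
        ((addWire_ofTerm (k := 2) (l := 2) _).symm.trans
          ((congrArg addWire braid_one_one).trans (addWire_ofTerm _)))

theorem sw_sw (n : ℕ) : sw n ≫ sw n = 𝟙 (mk (n + 2)) := by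
  rw [sw, ← addLeft_comp, ← addLeft_id n 2, ← braid_one_one]
  exact congrArg (addLeft n) (ofTerm_eq (.braid_symm (T := escfmTheory) 1 1))

theorem un_sw (n : ℕ) : un (n + 1) ≫ sw n = addWire (un n) := by
  rw [un_succ, sw, un, addWire_addLeft_ofTerm, ← addLeft_comp]
  refine congrArg (addLeft n) ?_
  have h := ofTerm_eq (.braid_natural (T := escfmTheory) .one (.gen .unit))
  rw [ofTerm_comp, ofTerm_comp] at h
  rw [← braid_one_one]
  exact h.trans ((congrArg (fun f : mk 1 ⟶ mk 1 => f ≫ ofTerm (.tensor (.gen .unit) .one))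
    braid_one_zero).trans (Category.id_comp _))

theorem sw_ep (n : ℕ) : sw n ≫ ep (n + 1) = addWire (ep n) := by
  rw [ep_succ, sw, ep, addWire_addLeft_ofTerm, ← addLeft_comp]
  refine congrArg (addLeft n) ?_
  have h := ofTerm_eq (.braid_natural (T := escfmTheory) .one (.gen .counit))
  rw [ofTerm_comp, ofTerm_comp] at h
  have h2 : ofTerm (.tensor .one (.gen .counit)) = ofTerm (braid _ 1 1) ≫
      ofTerm (.tensor (.gen .counit) .one) :=
    (Category.comp_id _).symm.trans ((congrArg (fun f : mk 1 ⟶ mk 1 =>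
      ofTerm (.tensor .one (.gen .counit)) ≫ f) braid_one_zero).symm.trans h)
  rw [h2, ← braid_one_one, ← Category.assoc]
  exact (congrArg (fun f : mk 2 ⟶ mk 2 => f ≫ ofTerm (.tensor (.gen .counit) .one))
    (ofTerm_eq (.braid_symm (T := escfmTheory) 1 1))).trans (Category.id_comp _)

theorem co_sw_sw (n : ℕ) :
    sw n ≫ co (n + 1) = addWire (co n) ≫ sw (n + 1) ≫ addWire (sw n) := by
  rw [co_succ, sw_succ, sw, co, addWire_addLeft_ofTerm, addWire_addLeft_ofTerm]
  rw [← addLeft_comp]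
  refine Eq.trans (congrArg (addLeft n) (a₂ := ofTerm (.tensor (n := 1) (m := 2) (.gen .comul) .one) ≫
    ofTerm (.tensor (p := 2) (q := 2) .one .swap) ≫ ofTerm (.tensor (n := 2) (m := 2) .swap .one)) ?_) ?_
  · rw [← braid_two_one, ← braid_one_one]
    exact (ofTerm_eq (.braid_natural (T := escfmTheory) (.gen .comul) .one)).symm
  · rw [addLeft_comp, addLeft_comp]

theorem mu_sw_sw (n : ℕ) :
    addWire (mu n) ≫ sw n = sw (n + 1) ≫ addWire (sw n) ≫ mu (n + 1) := by
  rw [mu_succ, sw_succ, sw, mu, addWire_addLeft_ofTerm, addWire_addLeft_ofTerm]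
  rw [← addLeft_comp]
  refine Eq.trans (congrArg (addLeft n) (a₂ :=
    (ofTerm (.tensor (p := 2) (q := 2) .one .swap) ≫ ofTerm (.tensor (n := 2) (m := 2) .swap .one)) ≫
      ofTerm (.tensor (p := 2) .one (.gen .mul))) ?_) ?_
  · rw [← braid_two_one, ← braid_one_one]
    exact ofTerm_eq (.braid_natural (T := escfmTheory) (.gen .mul) .one)
  · rw [addLeft_comp, addLeft_comp, Category.assoc]

/-- The Yang–Baxter equation is naturality of the block braiding `1 + 2` with respect to `swap`. -/
theorem sw_braid (n : ℕ) : sw (n + 1) ≫ addWire (sw n) ≫ sw (n + 1) =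
    addWire (sw n) ≫ sw (n + 1) ≫ addWire (sw n) := by
  rw [sw_succ, sw, addWire_addLeft_ofTerm]
  have h : ofTerm (.tensor (p := 2) (q := 2) .one .swap) ≫ ofTerm (braid _ 1 2) =
    ofTerm (braid _ 1 2) ≫ ofTerm (.tensor (n := 2) (m := 2) .swap .one) :=
    ofTerm_eq (.braid_natural (T := escfmTheory) .one .swap)
  rw [braid_one_two, Category.assoc] at h
  have h' := congrArg (addLeft n) h
  rw [addLeft_comp, addLeft_comp, addLeft_comp, addLeft_comp] at h'
  exact h'

theorem addLeft_one (n : ℕ) : addLeft n (ofTerm .one) = 𝟙 (mk (n + 1)) := by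
  rw [ofTerm_one, addLeft_id]

theorem addLeft_empty (n : ℕ) : addLeft n (ofTerm .empty) = 𝟙 (mk n) := by
  rw [ofTerm_empty, addLeft_id]; rfl

theorem addLeft_comp_eqn (n : ℕ) {k l p : ℕ} (a : EscfmTerm k l) (b : EscfmTerm l p)
    (t : EscfmTerm k p) (h : EscfmEqn (.comp a b) t) :
    addLeft n (ofTerm a) ≫ addLeft n (ofTerm b) = addLeft n (ofTerm t) := by
  rw [← addLeft_comp]
  exact congrArg (addLeft n) (ofTerm_eq (.eqn (T := escfmTheory) h))

theorem addLeft_comp_eqn_comp (n : ℕ) {k l l' p : ℕ} (a : EscfmTerm k l) (b : EscfmTerm l p)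
    (c : EscfmTerm k l') (d : EscfmTerm l' p) (h : EscfmEqn (.comp a b) (.comp c d)) :
    addLeft n (ofTerm a) ≫ addLeft n (ofTerm b) = addLeft n (ofTerm c) ≫ addLeft n (ofTerm d) :=
  (addLeft_comp_eqn n a b _ h).trans (addLeft_comp n (ofTerm c) (ofTerm d))

theorem co_mu (n : ℕ) : co n ≫ mu n = 𝟙 (mk (n + 1)) :=
  (addLeft_comp_eqn n _ _ _ .special).trans (addLeft_one n)

theorem un_ep (n : ℕ) : un n ≫ ep n = 𝟙 (mk n) :=
  (addLeft_comp_eqn n _ _ _ .extra).trans (addLeft_empty n)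

theorem sw_mu (n : ℕ) : sw n ≫ mu n = mu n :=
  addLeft_comp_eqn n _ _ _ .comm

theorem co_sw (n : ℕ) : co n ≫ sw n = co n :=
  addLeft_comp_eqn n _ _ _ .cocomm

theorem un_mu (n : ℕ) : addWire (un n) ≫ mu n = 𝟙 (mk (n + 1)) := by
  rw [un, addWire_addLeft_ofTerm]
  exact (addLeft_comp_eqn n _ _ _ .unital).trans (addLeft_one n)

theorem co_ep (n : ℕ) : co n ≫ addWire (ep n) = 𝟙 (mk (n + 1)) := by
  rw [ep, addWire_addLeft_ofTerm]
  exact (addLeft_comp_eqn n _ _ _ .counital).trans (addLeft_one n)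

theorem co_co (n : ℕ) : co n ≫ addWire (co n) = co n ≫ co (n + 1) := by
  rw [co_succ, co, addWire_addLeft_ofTerm]
  exact addLeft_comp_eqn_comp n _ _ _ _ .coassoc

theorem addWire_co_mu (n : ℕ) : addWire (co n) ≫ mu (n + 1) = mu n ≫ co n := by
  rw [mu_succ, co, addWire_addLeft_ofTerm]
  exact addLeft_comp_eqn_comp n _ _ _ _ .frobenius_left

theorem addWire_co (n : ℕ) :
    addWire (co n) = sw n ≫ co (n + 1) ≫ addWire (sw n) ≫ sw (n + 1) := by
  rw [reassoc_of% co_sw_sw n, ← reassoc_of% addWire_comp (sw n) (sw n), sw_sw, addWire_id,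
    Category.id_comp, sw_sw, Category.comp_id]

/-! ### Copying an arbitrary wire. -/

/-- Copying wire `i` to a new wire at the end. -/
def copy : (n : ℕ) → Fin n → (mk n ⟶ mk (n + 1))
  | 0, i => i.elim0
  | n + 1, i => Fin.lastCases (motive := fun _ => mk (n + 1) ⟶ mk (n + 2)) (co n)
      (fun j => addWire (copy n j) ≫ sw n) i

theorem copy_last (n : ℕ) : copy (n + 1) (Fin.last n) = co n := by simp [copy]

theorem copy_castSucc (n : ℕ) (j : Fin n) :
    copy (n + 1) j.castSucc = addWire (copy n j) ≫ sw n := by simp [copy]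

/-- Two copies may be made in either order, up to exchanging the two new wires. For different wires
this is naturality of the braiding; for the same wire it is coassociativity and cocommutativity. -/
theorem copy_addWire_copy_sw {n : ℕ} (k i : Fin n) :
    copy n k ≫ addWire (copy n i) ≫ sw n = copy n i ≫ addWire (copy n k) := by
  induction n with
  | zero => exact k.elim0
  | succ n ih =>
    have key : ∀ i : Fin n, co n ≫ addWire (copy (n + 1) i.castSucc) ≫ sw (n + 1) =
        copy (n + 1) i.castSucc ≫ addWire (co n) := by
      intro i
      rw [copy_castSucc, addWire_comp, Category.assoc, reassoc_of% naturality_co (copy n i), addWire_co,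
        Category.assoc, reassoc_of% sw_sw n]
    induction k using Fin.lastCases with
    | last =>
      induction i using Fin.lastCases with
      | last => rw [copy_last, reassoc_of% co_co n, co_sw, co_co]
      | cast i => rw [copy_last, key]
    | cast k =>
      induction i using Fin.lastCases with
      | last =>
        rw [copy_last, ← reassoc_of% key k, sw_sw]; simp
      | cast i =>
        simp only [copy_castSucc, addWire_comp, Category.assoc]
        have ih' := congrArg addWire (ih k i)
        simp only [addWire_comp] at ih'
        rw [reassoc_of% naturality_sw (copy n i), reassoc_of% naturality_sw (copy n k), sw_braid,
          reassoc_of% ih']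

theorem copy_addWire_copy {n : ℕ} (j : Fin n) :
    copy n j ≫ addWire (copy n j) = copy n j ≫ co n := by
  induction n with
  | zero => exact j.elim0
  | succ n ih =>
    induction j using Fin.lastCases with
    | last => rw [copy_last, co_co]
    | cast j =>
      have ih' := congrArg addWire (ih j)
      simp only [addWire_comp] at ih'
      simp only [copy_castSucc, addWire_comp, Category.assoc]
      rw [reassoc_of% naturality_sw (copy n j), reassoc_of% ih', ← co_sw_sw]

theorem copy_ep {n : ℕ} (j : Fin n) : copy n j ≫ ep n = 𝟙 (mk n) := by
  induction n with
  | zero => exact j.elim0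
  | succ n ih =>
    induction j using Fin.lastCases with
    | last => rw [copy_last, ← co_sw, Category.assoc, sw_ep, co_ep]
    | cast j => rw [copy_castSucc, Category.assoc, sw_ep, ← addWire_comp, ih, addWire_id]

/-- The braiding of two adjacent wires. -/
inductive IsSwap : {n : ℕ} → (mk n ⟶ mk n) → Prop
  | sw (n : ℕ) : IsSwap (sw n)
  | addWire {n : ℕ} {f : mk n ⟶ mk n} : IsSwap f → IsSwap (addWire f)

/-- Here `j` is the position to which the transposition `f` moves wire `i`. -/
theorem IsSwap.copy_comm {n : ℕ} {f : mk n ⟶ mk n} (hf : IsSwap f) (i : Fin n) :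
    ∃ j, copy n i ≫ EscfmObj.addWire f = f ≫ copy n j := by
  induction hf with
  | sw n =>
    induction i using Fin.lastCases with
    | last =>
      refine ⟨Fin.castSucc (Fin.last n), ?_⟩
      rw [copy_castSucc, copy_last, copy_last, addWire_co, Category.assoc, Category.assoc,
        Category.assoc, sw_sw, Category.comp_id, reassoc_of% sw_sw n]
    | cast i =>
      induction i using Fin.lastCases with
      | last =>
        refine ⟨Fin.last _, ?_⟩
        rw [copy_castSucc, copy_last, copy_last, co_sw_sw, Category.assoc]
      | cast i =>
        refine ⟨i.castSucc.castSucc, ?_⟩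
        simp only [copy_castSucc, addWire_comp, Category.assoc]
        rw [← sw_braid, reassoc_of% naturality_sw (copy n i)]
  | @addWire n f hf ih =>
    induction i using Fin.lastCases with
    | last => exact ⟨Fin.last n, by rw [copy_last, naturality_co]⟩
    | cast i =>
      obtain ⟨j, hj⟩ := ih i
      refine ⟨j.castSucc, ?_⟩
      rw [copy_castSucc, copy_castSucc, Category.assoc, naturality_sw, ← reassoc_of% addWire_comp,
        hj, addWire_comp, Category.assoc]

/-! ### Self-duality, and connecting two wires. -/

/-- Capping off the last two wires. -/
def cap (n : ℕ) : mk (n + 2) ⟶ mk n := mu n ≫ ep n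

/-- Two new connected wires at the end. -/
def cup (n : ℕ) : mk n ⟶ mk (n + 2) := un n ≫ co n

theorem sw_cap (n : ℕ) : sw n ≫ cap n = cap n := by rw [cap, reassoc_of% sw_mu n]

theorem naturality_cap {n m : ℕ} (f : mk n ⟶ mk m) :
    addWire (addWire f) ≫ cap m = cap n ≫ f := by
  rw [cap, cap, ← reassoc_of% naturality_mu f, naturality_ep, Category.assoc]

theorem co_ep_succ (n : ℕ) : co n ≫ ep (n + 1) = 𝟙 (mk (n + 1)) := by
  rw [← copy_last, copy_ep]

/-- By the Frobenius law the multiplication is a comultiplication followed by a cap, so `mu` needs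
no case of its own in the normal form argument. -/
theorem mu_eq (n : ℕ) : mu n = addWire (co n) ≫ cap (n + 1) := by
  rw [cap, reassoc_of% addWire_co_mu n, co_ep_succ, Category.comp_id]

theorem cup_cap (n : ℕ) : addWire (cup n) ≫ cap (n + 1) = 𝟙 (mk (n + 1)) := by
  rw [cup, addWire_comp, Category.assoc, ← mu_eq, un_mu]

theorem co_cap (n : ℕ) : co n ≫ cap n = ep n := by
  rw [cap, reassoc_of% co_mu n]

theorem un_cap (n : ℕ) : un (n + 1) ≫ cap n = ep n := by
  rw [← sw_cap, reassoc_of% un_sw n, cap, reassoc_of% un_mu n]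

/-- Bending the last input wire to an output. -/
theorem addWire_cap_injective {n m : ℕ} {s t : mk (n + 1) ⟶ mk m}
    (h : cup n ≫ addWire s = cup n ≫ addWire t) : s = t := by
  -- Bending the wire back recovers `s`, by the snake identity `cup_cap`.
  have key : ∀ s : mk (n + 1) ⟶ mk m, s = addWire (cup n ≫ addWire s) ≫ cap m := by
    intro s
    rw [addWire_comp, Category.assoc, naturality_cap, reassoc_of% cup_cap n]
  rw [key s, h, ← key t]

/-- Connecting two wires. -/
def connect {n : ℕ} (i j : Fin n) : mk n ⟶ mk n := copy n j ≫ addWire (copy n i) ≫ cap n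

theorem connect_comm {n : ℕ} (i j : Fin n) : connect i j = connect j i := by
  rw [connect, ← sw_cap, reassoc_of% copy_addWire_copy_sw j i, connect]

/-- The special law enters here, through `co_cap`: closing a loop on a wire changes nothing. -/
theorem connect_self {n : ℕ} (i : Fin n) : connect i i = 𝟙 (mk n) := by
  rw [connect, reassoc_of% copy_addWire_copy i, co_cap, copy_ep]

theorem un_copy_castSucc {n : ℕ} (j : Fin n) :
    un n ≫ copy (n + 1) j.castSucc = copy n j ≫ addWire (un n) := by
  rw [copy_castSucc, reassoc_of% naturality_un (copy n j), un_sw]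

theorem un_connect_castSucc {n : ℕ} (i j : Fin n) :
    un n ≫ connect i.castSucc j.castSucc = connect i j ≫ un n := by
  have h := congrArg addWire (un_copy_castSucc i)
  simp only [addWire_comp] at h
  rw [connect, reassoc_of% un_copy_castSucc j, reassoc_of% h, naturality_cap]
  simp [connect]

/-- This lemma and its neighbours push a connection back past the creation of the last wire; if that
wire takes part, a fresh one becomes a copy and a copy is replaced by its original. -/
theorem copy_connect_castSucc {n : ℕ} (k i j : Fin n) :
    copy n k ≫ connect i.castSucc j.castSucc = connect i j ≫ copy n k := by
  have h := congrArg addWire (copy_addWire_copy_sw k i)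
  simp only [addWire_comp] at h
  rw [connect, copy_castSucc, copy_castSucc, addWire_comp]
  simp only [Category.assoc]
  rw [reassoc_of% naturality_sw (copy n i), ← reassoc_of% naturality_sw (copy n i),
    reassoc_of% copy_addWire_copy_sw k j, reassoc_of% h, naturality_cap]
  simp [connect]

theorem un_connect_last {n : ℕ} (j : Fin n) :
    un n ≫ connect (Fin.last n) j.castSucc = copy n j := by
  rw [connect, reassoc_of% un_copy_castSucc j, copy_last, ← reassoc_of% addWire_comp]
  exact (congrArg _ (cup_cap n)).trans (Category.comp_id _)

theorem copy_connect_last {n : ℕ} (k j : Fin n) :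
    copy n k ≫ connect (Fin.last n) j.castSucc = connect k j ≫ copy n k := by
  have h := congrArg addWire (copy_addWire_copy k)
  simp only [addWire_comp] at h
  rw [connect, copy_castSucc, copy_last]
  simp only [Category.assoc]
  rw [reassoc_of% copy_addWire_copy_sw k j, ← reassoc_of% h, naturality_cap]
  simp [connect]

/-! ### Normal forms of states and their closure properties. -/

/-- Normal forms: each wire is either new or a copy of an earlier one. -/
inductive IsNormal : {n : ℕ} → (mk 0 ⟶ mk n) → Prop
  | nil : IsNormal (𝟙 (mk 0))
  | un {n : ℕ} {s : mk 0 ⟶ mk n} : IsNormal s → IsNormal (s ≫ un n)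
  | copy {n : ℕ} {s : mk 0 ⟶ mk n} (i : Fin n) : IsNormal s → IsNormal (s ≫ copy n i)

namespace IsNormal

theorem comp_connect {n : ℕ} {s : mk 0 ⟶ mk n} (hs : IsNormal s) (i j : Fin n) :
    IsNormal (s ≫ connect i j) := by
  induction hs with
  | nil => exact i.elim0
  | @un n s hs ih =>
    have key : ∀ j : Fin n, IsNormal ((s ≫ EscfmObj.un n) ≫ connect (Fin.last n) j.castSucc) := by
      intro j
      rw [Category.assoc, un_connect_last]
      exact .copy j hs
    induction i using Fin.lastCases with
    | last =>
      induction j using Fin.lastCases with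
      | last => rw [connect_self, Category.comp_id]; exact .un hs
      | cast j => exact key j
    | cast i =>
      induction j using Fin.lastCases with
      | last => rw [connect_comm]; exact key i
      | cast j =>
        rw [Category.assoc, un_connect_castSucc, ← Category.assoc]
        exact .un (ih i j)
  | @copy n s k hs ih =>
    have key : ∀ j : Fin n,
        IsNormal ((s ≫ EscfmObj.copy n k) ≫ connect (Fin.last n) j.castSucc) := by
      intro j
      rw [Category.assoc, copy_connect_last, ← Category.assoc]
      exact .copy k (ih k j)
    induction i using Fin.lastCases with
    | last =>
      induction j using Fin.lastCases with
      | last => rw [connect_self, Category.comp_id]; exact .copy k hs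
      | cast j => exact key j
    | cast i =>
      induction j using Fin.lastCases with
      | last => rw [connect_comm]; exact key i
      | cast j =>
        rw [Category.assoc, copy_connect_castSucc, ← Category.assoc]
        exact .copy k (ih i j)

/-- Discarding a fresh wire is the extra law, discarding a copy is counitality. -/
theorem comp_ep {n : ℕ} {s : mk 0 ⟶ mk (n + 1)} (hs : IsNormal s) : IsNormal (s ≫ ep n) := by
  cases hs with
  | un hs => rwa [Category.assoc, un_ep, Category.comp_id]
  | copy i hs => rwa [Category.assoc, copy_ep, Category.comp_id]

theorem comp_co {n : ℕ} {s : mk 0 ⟶ mk (n + 1)} (hs : IsNormal s) : IsNormal (s ≫ co n) := by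
  rw [← copy_last]
  exact .copy _ hs

theorem comp_cap {n : ℕ} {s : mk 0 ⟶ mk (n + 2)} (hs : IsNormal s) : IsNormal (s ≫ cap n) := by
  cases hs with
  | un hs => rw [Category.assoc, un_cap]; exact hs.comp_ep
  | copy i hs =>
    induction i using Fin.lastCases with
    | last => rw [copy_last, Category.assoc, co_cap]; exact hs.comp_ep
    -- The last wire copies an earlier wire `i`. If its neighbour is fresh, the cap removes both; if
    -- the neighbour copies `j`, the cap connects `i` and `j`.
    | cast i =>
      cases hs with
      | un hs =>
        rw [copy_castSucc]
        simp only [Category.assoc]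
        rw [sw_cap, reassoc_of% naturality_un (EscfmObj.copy n i), un_cap, copy_ep,
          Category.comp_id]
        exact hs
      | copy j hs =>
        rw [copy_castSucc]
        simp only [Category.assoc]
        rw [sw_cap]
        exact hs.comp_connect i j

theorem comp_isSwap {n : ℕ} {f : mk n ⟶ mk n} (hf : IsSwap f) {s : mk 0 ⟶ mk n}
    (hs : IsNormal s) : IsNormal (s ≫ f) := by
  induction hf with
  | sw n =>
    cases hs with
    | un hs =>
      cases hs with
      | @un _ s hs =>
        rw [Category.assoc, un_sw, Category.assoc, naturality_un, ← Category.assoc]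
        exact .un (.un hs)
      | copy j hs =>
        rw [Category.assoc, un_sw, Category.assoc, ← un_copy_castSucc, ← Category.assoc]
        exact .copy _ (.un hs)
    | copy i hs =>
      induction i using Fin.lastCases with
      | last => rw [Category.assoc, copy_last, co_sw, ← copy_last]; exact .copy _ hs
      | cast i =>
        cases hs with
        | un hs =>
          rw [copy_castSucc]
          simp only [Category.assoc]
          rw [sw_sw, Category.comp_id, naturality_un, ← Category.assoc]
          exact .un (.copy i hs)
        | copy j hs =>
          rw [copy_castSucc]
          simp only [Category.assoc]
          rw [sw_sw, Category.comp_id, ← copy_addWire_copy_sw, ← copy_castSucc, ← Category.assoc]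
          exact .copy _ (.copy i hs)
  | @addWire n f hf ih =>
    cases hs with
    | un hs =>
      rw [Category.assoc, naturality_un, ← Category.assoc]
      exact .un (ih hs)
    | copy i hs =>
      obtain ⟨j, hj⟩ := hf.copy_comm i
      rw [Category.assoc, hj, ← Category.assoc]
      exact .copy j (ih hs)

end IsNormal

/-! ### Every term is layered, hence every state is normal. -/

/-- The morphisms composed of operations at the last wires and braidings of adjacent wires. -/
inductive IsLayered : {n m : ℕ} → (mk n ⟶ mk m) → Prop
  | id (n : ℕ) : IsLayered (𝟙 (mk n))
  | comp {n m p : ℕ} {f : mk n ⟶ mk m} {g : mk m ⟶ mk p} :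
      IsLayered f → IsLayered g → IsLayered (f ≫ g)
  | un (n : ℕ) : IsLayered (un n)
  | co (n : ℕ) : IsLayered (co n)
  | ep (n : ℕ) : IsLayered (ep n)
  | cap (n : ℕ) : IsLayered (cap n)
  | swap {n : ℕ} {f : mk n ⟶ mk n} : IsSwap f → IsLayered f

theorem IsLayered.isNormal_comp {n m : ℕ} {f : mk n ⟶ mk m} (hf : IsLayered f)
    {s : mk 0 ⟶ mk n} (hs : IsNormal s) : IsNormal (s ≫ f) := by
  induction hf with
  | id n => rwa [Category.comp_id]
  | comp _ _ ihf ihg => rw [← Category.assoc]; exact ihg (ihf hs)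
  | un n => exact hs.un
  | co n => exact hs.comp_co
  | ep n => exact hs.comp_ep
  | cap n => exact hs.comp_cap
  | swap hf => exact hs.comp_isSwap hf

namespace IsLayered

theorem sw (n : ℕ) : IsLayered (EscfmObj.sw n) := .swap (.sw n)

theorem addWire_sw (n : ℕ) : IsLayered (EscfmObj.addWire (EscfmObj.sw n)) :=
  .swap (.addWire (.sw n))

/-- The spare wire is first moved in front of the two capped wires. -/
theorem addWire_cap (n : ℕ) : EscfmObj.addWire (EscfmObj.cap n) =
    EscfmObj.sw (n + 1) ≫ EscfmObj.addWire (EscfmObj.sw n) ≫ EscfmObj.cap (n + 1) := by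
  rw [EscfmObj.cap, EscfmObj.cap, addWire_comp, ← reassoc_of% mu_sw_sw n, ← sw_ep]

theorem addWire {n m : ℕ} {f : mk n ⟶ mk m} (hf : IsLayered f) :
    IsLayered (EscfmObj.addWire f) := by
  induction hf with
  | id n => rw [addWire_id]; exact .id _
  | comp _ _ ihf ihg => rw [addWire_comp]; exact ihf.comp ihg
  | un n => rw [← un_sw]; exact .comp (.un _) (.sw _)
  | co n =>
    rw [addWire_co]
    exact .comp (.sw _) (.comp (.co _) (.comp (.addWire_sw _) (.sw _)))
  | ep n => rw [← sw_ep]; exact .comp (.sw _) (.ep _)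
  | cap n =>
    rw [addWire_cap]
    exact .comp (.sw _) (.comp (.addWire_sw _) (.cap _))
  | swap hf => exact .swap (.addWire hf)

theorem mu (n : ℕ) : IsLayered (EscfmObj.mu n) := by
  rw [mu_eq]
  exact .comp (.addWire (.co n)) (.cap _)

theorem ofTerm_cast_iff {n m n' m' : ℕ} (hn : n = n') (hm : m = m') (t : EscfmTerm n m) :
    IsLayered (ofTerm (t.cast hn hm)) ↔ IsLayered (ofTerm t) := by
  subst hn hm
  exact Iff.rfl

theorem tens_id {n m : ℕ} {f : mk n ⟶ mk m} (hf : IsLayered f) (k : ℕ) :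
    IsLayered (tens f (𝟙 (mk k))) := by
  induction k with
  | zero => rwa [tens_id_zero]
  | succ k ih => rw [tens_id_succ]; exact ih.addWire

theorem addLeft {k l : ℕ} (t : EscfmTerm k l) (n : ℕ) :
    IsLayered (EscfmObj.addLeft n (ofTerm t)) := by
  induction t generalizing n with
  | empty => rw [addLeft_empty]; exact .id n
  | one => rw [addLeft_one]; exact .id _
  | swap => exact .sw n
  | gen g =>
    cases g with
    | mul => exact .mu n
    | unit => exact .un n
    | comul => exact .co n
    | counit => exact .ep n
  | comp a b iha ihb => rw [ofTerm_comp, addLeft_comp]; exact (iha n).comp (ihb n)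
  | @tensor _ m p _ a c iha ihc =>
    -- Reassociated as `(n + a) + c`, the product performs `a` behind `n` wires and then `c` behind
    -- `n + m` wires. For this the induction needs arbitrary `n`.
    have h : IsLayered (ofTerm (.tensor (.tensor (PropTerm.idn _ n) a) c)) := by
      rw [ofTerm_tensor, tens_eq]
      exact .comp ((iha n).tens_id p) (ihc (n + m))
    rw [ofTerm_eq (.tensor_assoc (T := escfmTheory) (PropTerm.idn _ n) a c),
      ofTerm_cast_iff] at h
    exact h

theorem ofTerm {k l : ℕ} (t : EscfmTerm k l) : IsLayered (ofTerm t) := by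
  have h := addLeft t 0
  rwa [EscfmObj.addLeft, ← ofTerm_empty, ← ofTerm_tensor,
    ofTerm_eq (.empty_tensor (T := escfmTheory) t), ofTerm_cast_iff] at h

end IsLayered

theorem isNormal {n : ℕ} (s : mk 0 ⟶ mk n) : IsNormal s := by
  obtain ⟨t, rfl⟩ := ofTerm_surjective s
  have h := (IsLayered.ofTerm t).isNormal_comp .nil
  rwa [Category.id_comp] at h

end EscfmObj

/-! ### Boolean labellings as an invariant of terms. -/

/-- The labellings of the wires by Booleans that are compatible with a term. -/
def EscfmTerm.Labels : {n m : ℕ} → EscfmTerm n m → (Fin n → Bool) → (Fin m → Bool) → Prop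
  | _, _, .empty, _, _ => True
  | _, _, .one, x, y => x = y
  | _, _, .swap, x, y => x 0 = y 1 ∧ x 1 = y 0
  | _, _, .gen _, x, y => ∀ i j, Sum.elim x y i = Sum.elim x y j
  | _, _, .comp a b, x, y => ∃ z, Labels a x z ∧ Labels b z y
  | _, _, .tensor (n := n) (m := m) (p := p) (q := q) a c, x, y =>
      Labels a (x ∘ Fin.castAdd p) (y ∘ Fin.castAdd q) ∧ Labels c (x ∘ Fin.natAdd n) (y ∘ Fin.natAdd m)

namespace EscfmTerm

theorem funext_append {n m : ℕ} {x y : Fin (n + m) → Bool} :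
    x = y ↔ x ∘ Fin.castAdd m = y ∘ Fin.castAdd m ∧ x ∘ Fin.natAdd n = y ∘ Fin.natAdd n := by
  refine ⟨by rintro rfl; simp, fun ⟨h1, h2⟩ => funext fun i => ?_⟩
  induction i using Fin.addCases with
  | left i => exact congrFun h1 i
  | right i => exact congrFun h2 i

theorem append_comp_castAdd {n m : ℕ} (x : Fin n → Bool) (y : Fin m → Bool) :
    Fin.append x y ∘ Fin.castAdd m = x := by ext; simp

theorem append_comp_natAdd {n m : ℕ} (x : Fin n → Bool) (y : Fin m → Bool) :
    Fin.append x y ∘ Fin.natAdd n = y := by ext; simp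

theorem labels_idn (n : ℕ) (x y : Fin n → Bool) :
    Labels (PropTerm.idn _ n) x y ↔ x = y := by
  induction n with
  | zero => simp [PropTerm.idn, Labels, Subsingleton.elim x y]
  | succ n ih =>
    rw [funext_append (n := n) (m := 1), PropTerm.idn, Labels, ih]; rfl

theorem labels_cast {n m n' m' : ℕ} (hn : n = n') (hm : m = m') (t : EscfmTerm n m)
    (x : Fin n' → Bool) (y : Fin m' → Bool) :
    Labels (t.cast hn hm) x y ↔ Labels t (x ∘ Fin.cast hn) (y ∘ Fin.cast hm) := by
  subst hn hm; rfl

/-- A term each of whose output wires is connected to exactly one input wire. -/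
def IsWiring {n m : ℕ} (t : EscfmTerm n m) (σ : Fin m → Fin n) : Prop :=
  ∀ x y, Labels t x y ↔ y = x ∘ σ

/-- Wirings serve to compute the labellings of the recursively defined braidings. The map `σ` goes
from outputs to inputs, hence the contravariance. -/
theorem isWiring_comp {n m p : ℕ} {s : EscfmTerm n m} {t : EscfmTerm m p} {σ : Fin m → Fin n}
    {τ : Fin p → Fin m} (hs : IsWiring s σ) (ht : IsWiring t τ) :
    IsWiring (.comp s t) (σ ∘ τ) := by
  intro x y
  simp only [Labels, hs x, ht _ y, exists_eq_left]; rfl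

theorem isWiring_tensor {n m p q : ℕ} {s : EscfmTerm n m} {t : EscfmTerm p q} {σ : Fin m → Fin n}
    {τ : Fin q → Fin p} (hs : IsWiring s σ) (ht : IsWiring t τ) :
    IsWiring (.tensor s t) (Fin.addCases (Fin.castAdd p ∘ σ) (Fin.natAdd n ∘ τ)) := by
  intro x y
  simp only [Labels, hs _ _, ht _ _]
  rw [funext_append]
  refine and_congr ?_ ?_ <;> simp [funext_iff]

theorem IsWiring.congr {n m : ℕ} {t : EscfmTerm n m} {σ τ : Fin m → Fin n} (h : IsWiring t σ)
    (hστ : σ = τ) : IsWiring t τ := hστ ▸ h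

theorem isWiring_idn (n : ℕ) : IsWiring (PropTerm.idn _ n) id := fun x y => by
  rw [labels_idn]; exact eq_comm

theorem isWiring_one : IsWiring .one id := fun _ _ => eq_comm

theorem isWiring_cast {n m n' m' : ℕ} (hn : n = n') (hm : m = m') {t : EscfmTerm n m}
    {σ : Fin m → Fin n} (ht : IsWiring t σ) :
    IsWiring (t.cast hn hm) (Fin.cast hn ∘ σ ∘ Fin.cast hm.symm) := by
  subst hn hm; exact ht

theorem finAddFlip_val {m n : ℕ} (i : Fin (m + n)) :
    (finAddFlip i).val = if i.val < m then n + i.val else i.val - m := by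
  induction i using Fin.addCases with
  | left i => simp
  | right i => simp

theorem finAddFlip_finAddFlip {m n : ℕ} (i : Fin (m + n)) : finAddFlip (finAddFlip i) = i := by
  ext
  have := i.isLt
  simp only [finAddFlip_val]
  split_ifs <;> omega

theorem addCases_val {m n p : ℕ} (f : Fin m → Fin p) (g : Fin n → Fin p) (i : Fin (m + n)) :
    (Fin.addCases (motive := fun _ => Fin p) f g i).val =
      if h : i.val < m then (f ⟨i, h⟩).val else (g ⟨i - m, by omega⟩).val := by
  induction i using Fin.addCases with
  | left i => simp
  | right i => simp

theorem isWiring_swap : IsWiring .swap Fin.rev := by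
  intro x y
  simp only [Labels, funext_iff, Fin.forall_fin_two, Function.comp]
  exact ⟨fun h => ⟨h.2.symm, h.1.symm⟩, fun h => ⟨h.2.symm, h.1.symm⟩⟩

theorem isWiring_braidOne (m : ℕ) : IsWiring (PropTerm.braidOne _ m) finAddFlip := by
  induction m with
  | zero =>
    intro x y
    simp only [PropTerm.braidOne, Labels]
    rw [eq_comm]
    refine Eq.congr rfl (funext fun i => congrArg x (Subsingleton.elim (α := Fin 1) _ _))
  | succ m ih =>
    have h := isWiring_comp (isWiring_tensor (p := 1) (q := 1) ih isWiring_one)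
      (isWiring_tensor (p := 2) (q := 2) (isWiring_idn m) isWiring_swap)
    refine h.congr (funext fun i => Fin.ext ?_)
    have hi := i.isLt
    rw [finAddFlip_val]
    simp only [Function.comp, addCases_val, id, Fin.val_castAdd, Fin.val_natAdd, finAddFlip_val, Fin.val_rev]
    split_ifs <;> simp_all <;> omega

theorem isWiring_braid (n m : ℕ) : IsWiring (PropTerm.braid _ n m) finAddFlip := by
  induction n with
  | zero =>
    have h := isWiring_cast (Nat.zero_add m).symm rfl (isWiring_idn m)
    refine h.congr (funext fun i => Fin.ext ?_)
    rw [finAddFlip_val]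
    simp
  | succ n ih =>
    have h := isWiring_comp (isWiring_cast (Nat.add_assoc n 1 m).symm (Nat.add_assoc n m 1).symm
      (isWiring_tensor (isWiring_idn n) (isWiring_braidOne m)))
      (isWiring_tensor (p := 1) (q := 1) ih isWiring_one)
    refine h.congr (funext fun i => Fin.ext ?_)
    have hi := i.isLt
    rw [finAddFlip_val]
    simp only [Function.comp, addCases_val, id, Fin.val_castAdd, Fin.val_natAdd, finAddFlip_val, Fin.val_cast]
    split_ifs <;> simp_all <;> omega

theorem exists_fin_one {P : (Fin 1 → Bool) → Prop} : (∃ z, P z) ↔ ∃ a, P ![a] := by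
  refine ⟨fun ⟨z, h⟩ => ⟨z 0, ?_⟩, fun ⟨_, h⟩ => ⟨_, h⟩⟩
  convert h using 1
  ext i; fin_cases i; rfl

theorem exists_fin_two {P : (Fin 2 → Bool) → Prop} : (∃ z, P z) ↔ ∃ a b, P ![a, b] := by
  refine ⟨fun ⟨z, h⟩ => ⟨z 0, z 1, ?_⟩, fun ⟨_, _, h⟩ => ⟨_, h⟩⟩
  convert h using 1
  ext i; fin_cases i <;> rfl

theorem exists_fin_three {P : (Fin 3 → Bool) → Prop} : (∃ z, P z) ↔ ∃ a b c, P ![a, b, c] := by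
  refine ⟨fun ⟨z, h⟩ => ⟨z 0, z 1, z 2, ?_⟩, fun ⟨_, _, _, h⟩ => ⟨_, h⟩⟩
  convert h using 1
  ext i; fin_cases i <;> rfl

/-- Once the labels of the intermediate wires are written out as tuples, each equation is a finite
check on Booleans. The extra law holds because a closed component always admits a label. -/
theorem labels_eqn {n m : ℕ} {s t : EscfmTerm n m} (h : EscfmEqn s t) (x : Fin n → Bool)
    (y : Fin m → Bool) : Labels s x y ↔ Labels t x y := by
  cases h
  case assoc =>
    change (∃ z : Fin 2 → Bool, _) ↔ (∃ z : Fin 2 → Bool, _)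
    rw [exists_fin_two, exists_fin_two]
    simp [Labels, funext_iff, Fin.forall_fin_two]
    grind
  case unital =>
    change (∃ z : Fin 2 → Bool, _) ↔ _
    rw [exists_fin_two]
    simp [Labels, funext_iff, Fin.forall_fin_two]
    grind
  case comm =>
    change (∃ z : Fin 2 → Bool, _) ↔ _
    rw [exists_fin_two]
    simp [Labels, Fin.forall_fin_two]
    grind
  case coassoc =>
    change (∃ z : Fin 2 → Bool, _) ↔ (∃ z : Fin 2 → Bool, _)
    rw [exists_fin_two, exists_fin_two]
    simp [Labels, funext_iff, Fin.forall_fin_two]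
    grind
  case counital =>
    change (∃ z : Fin 2 → Bool, _) ↔ _
    rw [exists_fin_two]
    simp [Labels, funext_iff, Fin.forall_fin_two]
    grind
  case cocomm =>
    change (∃ z : Fin 2 → Bool, _) ↔ _
    rw [exists_fin_two]
    simp [Labels, Fin.forall_fin_two]
    grind
  case frobenius_left =>
    change (∃ z : Fin 3 → Bool, _) ↔ (∃ z : Fin 1 → Bool, _)
    rw [exists_fin_three, exists_fin_one]
    simp [Labels, funext_iff, Fin.forall_fin_two]
    cases x 0 <;> cases x 1 <;> cases y 0 <;> cases y 1 <;> simp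
  case frobenius_right =>
    change (∃ z : Fin 1 → Bool, _) ↔ (∃ z : Fin 3 → Bool, _)
    rw [exists_fin_one, exists_fin_three]
    simp [Labels, funext_iff, Fin.forall_fin_two]
    cases x 0 <;> cases x 1 <;> cases y 0 <;> cases y 1 <;> simp
  case special =>
    change (∃ z : Fin 2 → Bool, _) ↔ _
    rw [exists_fin_two]
    simp [Labels, funext_iff, Fin.forall_fin_two]
    grind
  case extra =>
    change (∃ z : Fin 1 → Bool, _) ↔ _
    rw [exists_fin_one]
    simp [Labels]

theorem labels_congr {n m : ℕ} {s t : EscfmTerm n m} (h : escfmTheory.Rel s t) (x : Fin n → Bool)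
    (y : Fin m → Bool) : Labels s x y ↔ Labels t x y := by
  induction h with
  | refl => rfl
  | symm _ ih => exact (ih x y).symm
  | trans _ _ ih1 ih2 => exact (ih1 x y).trans (ih2 x y)
  | comp_congr _ _ ih1 ih2 => simp only [Labels, ih1, ih2]
  | tensor_congr _ _ ih1 ih2 => simp only [Labels, ih1, ih2]
  | id_comp a => simp [Labels, labels_idn]
  | comp_id a => simp [Labels, labels_idn]
  | comp_assoc a b c =>
    simp only [Labels]
    exact ⟨fun ⟨w, ⟨z, h1, h2⟩, h3⟩ => ⟨z, h1, w, h2, h3⟩,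
      fun ⟨z, h1, w, h2, h3⟩ => ⟨w, ⟨z, h1, h2⟩, h3⟩⟩
  | tensor_id n m => simp only [Labels, labels_idn, ← funext_append]
  | interchange a b a' b' =>
    simp only [Labels]
    constructor
    · rintro ⟨⟨z, h1, h2⟩, z', h3, h4⟩
      exact ⟨Fin.append z z', by simp only [append_comp_castAdd, append_comp_natAdd, *, and_self]⟩
    · rintro ⟨z, ⟨h1, h2⟩, h3, h4⟩
      exact ⟨⟨_, h1, h3⟩, _, h2, h4⟩
  | @empty_tensor n m a =>
    rw [labels_cast, Labels, Labels, true_and]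
    have h (k : ℕ) : Fin.natAdd 0 = Fin.cast (Nat.zero_add k).symm := by ext; simp
    rw [h, h]
  | tensor_empty a => simp only [Labels, and_true]; rfl
  | tensor_assoc a b c =>
    rw [labels_cast]
    simp only [Labels, and_assoc]
    have h1 (n n' n'' : ℕ) (x : Fin (n + n' + n'') → Bool) :
        (x ∘ Fin.castAdd n'') ∘ Fin.castAdd n' =
          (x ∘ Fin.cast (Nat.add_assoc n n' n'').symm) ∘ Fin.castAdd (n' + n'') := rfl
    have h2 (n n' n'' : ℕ) (x : Fin (n + n' + n'') → Bool) :
        (x ∘ Fin.castAdd n'') ∘ Fin.natAdd n =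
          ((x ∘ Fin.cast (Nat.add_assoc n n' n'').symm) ∘ Fin.natAdd n) ∘ Fin.castAdd n'' := rfl
    have h3 (n n' n'' : ℕ) (x : Fin (n + n' + n'') → Bool) :
        x ∘ Fin.natAdd (n + n') =
          ((x ∘ Fin.cast (Nat.add_assoc n n' n'').symm) ∘ Fin.natAdd n) ∘ Fin.natAdd n' :=
      funext fun i => congrArg x (Fin.ext (Nat.add_assoc n n' i))
    rw [h1, h1, h2, h2, h3, h3]
  | braid_natural a c =>
    have h {n m : ℕ} (u : Fin (n + m) → Bool) (w : Fin (m + n) → Bool) :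
        w = u ∘ finAddFlip ↔ u = w ∘ finAddFlip :=
      ⟨by rintro rfl; ext; simp [finAddFlip_finAddFlip],
        by rintro rfl; ext; simp [finAddFlip_finAddFlip]⟩
    have h1 {n m : ℕ} (u : Fin (n + m) → Bool) :
        (u ∘ finAddFlip) ∘ Fin.castAdd n = u ∘ Fin.natAdd n := by ext; simp
    have h2 {n m : ℕ} (u : Fin (n + m) → Bool) :
        (u ∘ finAddFlip) ∘ Fin.natAdd m = u ∘ Fin.castAdd m := by ext; simp
    simp only [Labels, isWiring_braid _ _ _ _]
    simp only [h _ y, exists_eq_left, exists_eq_right, h1, h2]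
    exact and_comm
  | braid_symm n m =>
    rw [isWiring_comp (isWiring_braid n m) (isWiring_braid m n), labels_idn, eq_comm]
    rw [show x ∘ finAddFlip ∘ finAddFlip = x from funext fun i => by simp [finAddFlip_finAddFlip]]
  | eqn h => exact labels_eqn h x y

/-! ### Labellings and corelations. -/

/-- The labellings that are constant on the blocks of a corelation. -/
def _root_.Corelation.Compat {X Y : Type} (α : Corelation X Y) (x : X → Bool) (y : Y → Bool) :
    Prop := α ≤ Setoid.ker (Sum.elim x y)

theorem _root_.Corelation.eq_of_compat {X Y : Type} {α β : Corelation X Y}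
    (h : ∀ x y, α.Compat x y ↔ β.Compat x y) : α = β := by
  classical
  have key : ∀ {α β : Corelation X Y}, (∀ x y, β.Compat x y → α.Compat x y) → α ≤ β := by
    intro α β h a b hab
    -- The indicator of the `β`-block of `a` is constant on `β`-blocks, hence on `α`-blocks, so it
    -- cannot separate `a` from `b`.
    let f : X ⊕ Y → Bool := fun c => decide (β a c)
    have hf : Sum.elim (f ∘ Sum.inl) (f ∘ Sum.inr) = f := Sum.elim_comp_inl_inr f
    have h2 := h (f ∘ Sum.inl) (f ∘ Sum.inr)
    unfold Corelation.Compat at h2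
    rw [hf] at h2
    have h3 : β ≤ Setoid.ker f := fun c d hcd => by
      simp only [Setoid.ker_def, f, decide_eq_decide]
      exact ⟨fun h => β.trans h hcd, fun h => β.trans h (β.symm hcd)⟩
    have h4 : f a = f b := h2 h3 hab
    have h5 : f a = true := decide_eq_true (β.refl a)
    exact of_decide_eq_true (h4.symm.trans h5)
  exact le_antisymm (key fun x y => (h x y).2) (key fun x y => (h x y).1)

theorem _root_.Corelation.compat_comp {X Y Z : Type} (α : Corelation X Y) (β : Corelation Y Z)
    (x : X → Bool) (z : Z → Bool) :
    (α.comp β).Compat x z ↔ ∃ y, α.Compat x y ∧ β.Compat y z := by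
  classical
  constructor
  · intro h
    set r : Setoid (X ⊕ (Y ⊕ Z)) := sInf {r : Setoid (X ⊕ (Y ⊕ Z)) |
      α ≤ r.comap (Sum.elim Sum.inl (Sum.inr ∘ Sum.inl)) ∧ β ≤ r.comap Sum.inr} with hr
    have hα : α ≤ r.comap (Sum.elim Sum.inl (Sum.inr ∘ Sum.inl)) :=
      fun a b hab s hs => hs.1 hab
    have hβ : β ≤ r.comap Sum.inr := fun a b hab s hs => hs.2 hab
    let ι : X ⊕ Z → X ⊕ (Y ⊕ Z) := Sum.elim Sum.inl (Sum.inr ∘ Sum.inr)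
    have hι : ∀ p q, r (ι p) (ι q) → Sum.elim x z p = Sum.elim x z q := fun p q hpq => h hpq
    -- A point gets the label of the outer points in its block, which agree by `hι`; blocks lying
    -- entirely in `Y` get `false`.
    let f : X ⊕ (Y ⊕ Z) → Bool := fun w => decide (∃ p, r (ι p) w ∧ Sum.elim x z p = true)
    have hf : ∀ {v w}, r v w → f v = f w := fun {v w} hvw => by
      simp only [f, decide_eq_decide]
      exact exists_congr fun p => and_congr_left fun _ =>
        ⟨fun h => r.trans h hvw, fun h => r.trans h (r.symm hvw)⟩
    have hfι : ∀ p, f (ι p) = Sum.elim x z p := fun p => by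
      rw [Bool.eq_iff_iff]
      simp only [f, decide_eq_true_iff]
      exact ⟨fun ⟨q, hq, hq'⟩ => (hι q p hq).symm.trans hq', fun hp => ⟨p, r.refl _, hp⟩⟩
    refine ⟨fun y => f (.inr (.inl y)), ?_, ?_⟩
    · have e : Sum.elim x (fun y => f (.inr (.inl y))) =
          f ∘ Sum.elim Sum.inl (Sum.inr ∘ Sum.inl) := by
        ext (a | a)
        · exact (hfι (.inl a)).symm
        · rfl
      intro a b hab
      rw [e]
      exact hf (hα hab)
    · have e : Sum.elim (fun y => f (.inr (.inl y))) z = f ∘ Sum.inr := by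
        ext (a | a)
        · rfl
        · exact (hfι (.inr a)).symm
      intro a b hab
      rw [e]
      exact hf (hβ hab)
  · rintro ⟨y, hα, hβ⟩ a b hab
    -- The kernel of the joint labelling is one of the partitions over which the infimum is taken.
    have h := hab (Setoid.ker (Sum.elim x (Sum.elim y z)))
      ⟨fun c d hcd => ?_, fun c d hcd => hβ hcd⟩
    · rcases a with a | a <;> rcases b with b | b <;> exact h
    · have := hα hcd
      rcases c with c | c <;> rcases d with d | d <;> exact this

theorem _root_.Corelation.compat_finSum {n m p q : ℕ} (α : Corelation (Fin n) (Fin m))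
    (β : Corelation (Fin p) (Fin q)) (x : Fin (n + p) → Bool) (y : Fin (m + q) → Bool) :
    (α.finSum β).Compat x y ↔ α.Compat (x ∘ Fin.castAdd p) (y ∘ Fin.castAdd q) ∧
      β.Compat (x ∘ Fin.natAdd n) (y ∘ Fin.natAdd m) := by
  let G : Fin (n + p) ⊕ Fin (m + q) → Quotient α ⊕ Quotient β :=
    Sum.elim (Sum.map (fun x => Quotient.mk α (Sum.inl x)) (fun x' => Quotient.mk β (Sum.inl x')))
      (Sum.map (fun y => Quotient.mk α (Sum.inr y)) (fun y' => Quotient.mk β (Sum.inr y'))) ∘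
    Sum.map finSumFinEquiv.symm finSumFinEquiv.symm
  let i₁ : Fin n ⊕ Fin m → Fin (n + p) ⊕ Fin (m + q) := Sum.map (Fin.castAdd p) (Fin.castAdd q)
  let i₂ : Fin p ⊕ Fin q → Fin (n + p) ⊕ Fin (m + q) := Sum.map (Fin.natAdd n) (Fin.natAdd m)
  have hG₁ : ∀ a, G (i₁ a) = Sum.inl (Quotient.mk α a) := by rintro (a | a) <;> simp [G, i₁]
  have hG₂ : ∀ a, G (i₂ a) = Sum.inr (Quotient.mk β a) := by rintro (a | a) <;> simp [G, i₂]
  have h₁ : ∀ a, Sum.elim (x ∘ Fin.castAdd p) (y ∘ Fin.castAdd q) a = Sum.elim x y (i₁ a) := by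
    rintro (a | a) <;> rfl
  have h₂ : ∀ a, Sum.elim (x ∘ Fin.natAdd n) (y ∘ Fin.natAdd m) a = Sum.elim x y (i₂ a) := by
    rintro (a | a) <;> rfl
  have cover : ∀ a, (∃ b, a = i₁ b) ∨ ∃ b, a = i₂ b := by
    rintro (a | a) <;> induction a using Fin.addCases with
    | left a => first | exact .inl ⟨.inl a, rfl⟩ | exact .inl ⟨.inr a, rfl⟩
    | right a => first | exact .inr ⟨.inl a, rfl⟩ | exact .inr ⟨.inr a, rfl⟩
  have hrel : ∀ a b, α.finSum β a b ↔ G a = G b := fun a b => Iff.rfl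
  constructor
  · intro h
    refine ⟨fun a b hab => ?_, fun a b hab => ?_⟩
    · rw [Setoid.ker_def, h₁, h₁]
      exact h ((hrel _ _).2 (by rw [hG₁, hG₁, Quotient.sound hab]))
    · rw [Setoid.ker_def, h₂, h₂]
      exact h ((hrel _ _).2 (by rw [hG₂, hG₂, Quotient.sound hab]))
  · rintro ⟨hα, hβ⟩ a b hab
    rw [hrel] at hab
    rw [Setoid.ker_def]
    obtain ⟨a, rfl⟩ | ⟨a, rfl⟩ := cover a <;> obtain ⟨b, rfl⟩ | ⟨b, rfl⟩ := cover b
    · rw [hG₁, hG₁] at hab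
      rw [← h₁, ← h₁]
      exact hα (Quotient.exact (Sum.inl.inj hab))
    · rw [hG₁, hG₂] at hab
      cases hab
    · rw [hG₁, hG₂] at hab
      cases hab
    · rw [hG₂, hG₂] at hab
      rw [← h₂, ← h₂]
      exact hβ (Quotient.exact (Sum.inr.inj hab))

theorem compat_corelation {n m : ℕ} (t : EscfmTerm n m) (x : Fin n → Bool) (y : Fin m → Bool) :
    (corelation t).Compat x y ↔ Labels t x y := by
  induction t with
  | empty => exact ⟨fun _ => trivial, fun _ a => by rcases a with a | a <;> exact a.elim0⟩
  | one =>
    constructor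
    · intro h
      exact funext fun i => @h (.inl i) (.inr i) rfl
    · rintro h a b -
      rcases a with a | a <;> rcases b with b | b <;>
        simp [Labels.eq_2 .. ▸ h, Subsingleton.elim a b]
  | swap =>
    constructor
    · intro h
      exact ⟨@h (.inl 0) (.inr 1) rfl, @h (.inl 1) (.inr 0) rfl⟩
    · rintro ⟨h0, h1⟩ a b hab
      rw [Setoid.ker_def] at hab ⊢
      have key : ∀ a, Sum.elim x y a = x (Sum.elim (fun i => i) Fin.rev a) := by
        rintro (a | a)
        · rfl
        · fin_cases a
          · exact h1.symm
          · exact h0.symm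
      rw [key, key, hab]
  | gen g => exact ⟨fun h a b => @h a b trivial, fun h a b _ => h a b⟩
  | comp a b iha ihb =>
    simp only [Labels, ← iha, ← ihb]
    exact Corelation.compat_comp _ _ x y
  | tensor a c iha ihc =>
    simp only [Labels, ← iha, ← ihc]
    exact Corelation.compat_finSum _ _ x y

theorem corelation_eq_iff {n m : ℕ} (s t : EscfmTerm n m) :
    corelation s = corelation t ↔ ∀ x y, Labels s x y ↔ Labels t x y := by
  simp only [← compat_corelation]
  exact ⟨fun h x y => by rw [h], Corelation.eq_of_compat⟩

end EscfmTerm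

namespace EscfmObj

/-! ### Labellings determine morphisms. -/

/-- The labellings of the wires by Booleans that are compatible with a morphism. -/
def Labels {n m : ℕ} (f : mk n ⟶ mk m) (x : Fin n → Bool) (y : Fin m → Bool) : Prop :=
  Quotient.lift (fun t : EscfmTerm n m => t.Labels x y)
    (fun _ _ h => propext (EscfmTerm.labels_congr h x y)) f

theorem labels_comp {n m p : ℕ} (f : mk n ⟶ mk m) (g : mk m ⟶ mk p) (x : Fin n → Bool)
    (y : Fin p → Bool) : Labels (f ≫ g) x y ↔ ∃ z, Labels f x z ∧ Labels g z y := by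
  obtain ⟨s, rfl⟩ := ofTerm_surjective f
  obtain ⟨t, rfl⟩ := ofTerm_surjective g
  rfl

theorem labels_tens {n m p q : ℕ} (f : mk n ⟶ mk m) (g : mk p ⟶ mk q)
    (x : Fin (n + p) → Bool) (y : Fin (m + q) → Bool) : Labels (tens f g) x y ↔
      Labels f (x ∘ Fin.castAdd p) (y ∘ Fin.castAdd q) ∧
      Labels g (x ∘ Fin.natAdd n) (y ∘ Fin.natAdd m) := by
  obtain ⟨s, rfl⟩ := ofTerm_surjective f
  obtain ⟨t, rfl⟩ := ofTerm_surjective g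
  rfl

theorem labels_id (n : ℕ) (x y : Fin n → Bool) : Labels (𝟙 (mk n)) x y ↔ x = y :=
  EscfmTerm.labels_idn n x y

theorem labels_addWire {n m : ℕ} (f : mk n ⟶ mk m) (x : Fin (n + 1) → Bool)
    (y : Fin (m + 1) → Bool) : Labels (addWire f) x y ↔
      Labels f (x ∘ Fin.castSucc) (y ∘ Fin.castSucc) ∧ x (Fin.last n) = y (Fin.last m) := by
  rw [addWire, labels_tens, labels_id, funext_iff, Fin.forall_fin_one]
  rfl

theorem labels_un (n : ℕ) (x : Fin n → Bool) (y : Fin (n + 1) → Bool) :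
    Labels (un n) x y ↔ y ∘ Fin.castSucc = x := by
  rw [un, addLeft, labels_tens, labels_id, eq_comm (b := x)]
  refine and_iff_left fun i j => ?_
  rcases i with i | i
  · exact i.elim0
  rcases j with j | j
  · exact j.elim0
  rw [Subsingleton.elim i j]

theorem labels_co (n : ℕ) (x : Fin (n + 1) → Bool) (y : Fin (n + 2) → Bool) :
    Labels (co n) x y ↔ y ∘ Fin.castSucc = x ∧ y (Fin.last (n + 1)) = x (Fin.last n) := by
  rw [co, addLeft, labels_tens, labels_id]
  constructor
  · rintro ⟨h1, h2⟩
    refine ⟨funext fun j => ?_, h2 (.inr 1) (.inl 0)⟩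
    induction j using Fin.lastCases with
    | last => exact h2 (.inr 0) (.inl 0)
    | cast j => exact (congrFun h1 j).symm
  · rintro ⟨rfl, h⟩
    refine ⟨rfl, ?_⟩
    have key : ∀ i, Sum.elim ((y ∘ Fin.castSucc) ∘ Fin.natAdd n) (y ∘ Fin.natAdd n) i =
        y (Fin.castSucc (Fin.last n)) := by
      rintro (i | i)
      · rw [Subsingleton.elim i 0]; rfl
      · obtain ⟨i, rfl⟩ | rfl := i.eq_castSucc_or_eq_last
        · rw [Subsingleton.elim i 0]; rfl
        · exact h
    exact fun i j => (key i).trans (key j).symm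

theorem labels_sw (n : ℕ) (x y : Fin (n + 2) → Bool) : Labels (sw n) x y ↔
    x ∘ Fin.castSucc ∘ Fin.castSucc = y ∘ Fin.castSucc ∘ Fin.castSucc ∧
      x (Fin.castSucc (Fin.last n)) = y (Fin.last (n + 1)) ∧
      x (Fin.last (n + 1)) = y (Fin.castSucc (Fin.last n)) := by
  rw [sw, addLeft, labels_tens, labels_id]
  rfl

theorem labels_copy {n : ℕ} (i : Fin n) (x : Fin n → Bool) (y : Fin (n + 1) → Bool) :
    Labels (copy n i) x y ↔ y ∘ Fin.castSucc = x ∧ y (Fin.last n) = x i := by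
  induction n with
  | zero => exact i.elim0
  | succ n ih =>
    induction i using Fin.lastCases with
    | last => rw [copy_last, labels_co]
    | cast i =>
      rw [copy_castSucc, labels_comp]
      simp only [labels_addWire, labels_sw, ih]
      constructor
      · rintro ⟨z, ⟨⟨h1, h2⟩, h3⟩, h4, h5, h6⟩
        refine ⟨funext fun j => ?_, ?_⟩
        · induction j using Fin.lastCases with
          | last => exact h6.symm.trans h3.symm
          | cast j => exact (congrFun h4 j).symm.trans (congrFun h1 j)
        · exact h5.symm.trans h2
      · rintro ⟨rfl, h⟩
        -- The labelling before the swap is `y` with its last two values exchanged.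
        refine ⟨Fin.snoc (α := fun _ => Bool) (Fin.snoc (α := fun _ => Bool)
          (y ∘ Fin.castSucc ∘ Fin.castSucc) (y (Fin.last _))) (y (Fin.castSucc (Fin.last n))),
          ⟨⟨?_, ?_⟩, ?_⟩, ?_, ?_, ?_⟩
        · ext; simp
        · simpa using h
        · simp
        · ext; simp
        · simp
        · simp

namespace IsNormal

theorem labels_const {n : ℕ} {s : mk 0 ⟶ mk n} (hs : IsNormal s) (b : Bool) (x : Fin 0 → Bool) :
    Labels s x (fun _ => b) := by
  induction hs with
  | nil => exact (labels_id _ _ _).2 (Subsingleton.elim _ _)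
  | un hs ih => exact (labels_comp _ _ _ _).2 ⟨_, ih, (labels_un _ _ _).2 rfl⟩
  | copy i hs ih => exact (labels_comp _ _ _ _).2 ⟨_, ih, (labels_copy _ _ _).2 ⟨rfl, rfl⟩⟩

end IsNormal

theorem labels_comp_un {n : ℕ} (s : mk 0 ⟶ mk n) (x : Fin 0 → Bool) (y : Fin (n + 1) → Bool) :
    Labels (s ≫ un n) x y ↔ Labels s x (y ∘ Fin.castSucc) := by
  simp [labels_comp, labels_un]

theorem labels_comp_copy {n : ℕ} (s : mk 0 ⟶ mk n) (i : Fin n) (x : Fin 0 → Bool)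
    (y : Fin (n + 1) → Bool) : Labels (s ≫ copy n i) x y ↔
      Labels s x (y ∘ Fin.castSucc) ∧ y (Fin.last n) = y i.castSucc := by
  simp only [labels_comp, labels_copy]
  constructor
  · rintro ⟨z, h, rfl, h'⟩
    exact ⟨h, h'⟩
  · rintro ⟨h, h'⟩
    exact ⟨_, h, rfl, h'⟩

namespace IsNormal

/-- A fresh wire is unconstrained: the old wires may all be `true` and the new one `false`. This
distinguishes it from a copy. -/
theorem exists_labels_snoc_ne {n : ℕ} {s : mk 0 ⟶ mk n} (hs : IsNormal s) (x : Fin 0 → Bool)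
    (j : Fin n) : ∃ y, Labels (s ≫ EscfmObj.un n) x y ∧ y (Fin.last n) ≠ y j.castSucc := by
  refine ⟨Fin.snoc (α := fun _ => Bool) (fun _ => true) false, ?_, by simp⟩
  rw [labels_comp_un]
  convert hs.labels_const true x
  simp

/-- A normal form does not fix which wire of a block is copied; this lemma shows that the choice is
immaterial. A fresh last wire is connected to no other, and a copy is traced back to its original.
-/
theorem comp_copy_eq {n : ℕ} {s : mk 0 ⟶ mk n} (hs : IsNormal s) (x : Fin 0 → Bool) (i j : Fin n)
    (h : ∀ y, Labels s x y → y i = y j) : s ≫ EscfmObj.copy n i = s ≫ EscfmObj.copy n j := by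
  induction hs with
  | nil => exact i.elim0
  | @un n s hs ih =>
    obtain ⟨i, rfl⟩ | rfl := i.eq_castSucc_or_eq_last <;>
      obtain ⟨j, rfl⟩ | rfl := j.eq_castSucc_or_eq_last
    · rw [Category.assoc, Category.assoc, un_copy_castSucc, un_copy_castSucc, ← Category.assoc,
        ← Category.assoc, ih i j fun y hy => ?_]
      have h' := h (Fin.snoc (α := fun _ => Bool) y false) ((labels_comp_un _ _ _).2 (by
        convert hy; ext; simp))
      simpa using h'
    · obtain ⟨y, hy, hne⟩ := hs.exists_labels_snoc_ne x i
      exact absurd (h y hy).symm hne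
    · obtain ⟨y, hy, hne⟩ := hs.exists_labels_snoc_ne x j
      exact absurd (h y hy) hne
    · rfl
  | @copy n s k hs ih =>
    have ext_label : ∀ y, Labels s x y → Labels (s ≫ EscfmObj.copy n k) x
        (Fin.snoc (α := fun _ => Bool) y (y k)) := fun y hy => by
      rw [labels_comp_copy]
      refine ⟨by convert hy; ext; simp, by simp⟩
    have key : ∀ j : Fin n, (∀ y, Labels (s ≫ EscfmObj.copy n k) x y → y (Fin.last n) = y j.castSucc) →
        (s ≫ EscfmObj.copy n k) ≫ EscfmObj.copy (n + 1) (Fin.last n) =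
          (s ≫ EscfmObj.copy n k) ≫ EscfmObj.copy (n + 1) j.castSucc := by
      intro j h
      -- The last wire is a copy of `k`, so `k` and `j` already carry equal labels in `s`, and the
      -- copy of `k` may be taken from `j` instead.
      have e := ih k j fun y hy => by simpa using h _ (ext_label y hy)
      rw [e, copy_last, copy_castSucc, Category.assoc, Category.assoc, copy_addWire_copy_sw,
        copy_addWire_copy]
    obtain ⟨i, rfl⟩ | rfl := i.eq_castSucc_or_eq_last <;>
      obtain ⟨j, rfl⟩ | rfl := j.eq_castSucc_or_eq_last
    · have e := ih i j fun y hy => by simpa using h _ (ext_label y hy)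
      simp only [copy_castSucc, Category.assoc]
      rw [copy_addWire_copy_sw, copy_addWire_copy_sw, ← Category.assoc, ← Category.assoc, e]
    · exact (key i fun y hy => (h y hy).symm).symm
    · exact key j h
    · rfl

theorem eq_of_labels {n : ℕ} {s t : mk 0 ⟶ mk n} (hs : IsNormal s) (ht : IsNormal t)
    (x : Fin 0 → Bool) (h : ∀ y, Labels s x y ↔ Labels t x y) : s = t := by
  induction hs with
  | nil => cases ht; rfl
  | @un n s hs ih =>
    cases ht with
    | @un _ t ht =>
      rw [ih ht fun y => ?_]
      have h' := h (Fin.snoc (α := fun _ => Bool) y false)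
      rw [labels_comp_un, labels_comp_un] at h'
      convert h' <;> ext <;> simp
    | copy j ht =>
      obtain ⟨y, hy, hne⟩ := hs.exists_labels_snoc_ne x j
      exact absurd ((labels_comp_copy _ _ _ _).1 ((h y).1 hy)).2 hne
  | @copy n s i hs ih =>
    cases ht with
    | un ht =>
      obtain ⟨y, hy, hne⟩ := ht.exists_labels_snoc_ne x i
      exact absurd ((labels_comp_copy _ _ _ _).1 ((h y).2 hy)).2 hne
    | @copy _ t j ht =>
      have e : ∀ (y : Fin n → Bool) b, (Fin.snoc (α := fun _ => Bool) y b) ∘ Fin.castSucc = y :=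
        fun y b => by ext; simp
      have h1 : ∀ y, Labels s x y → Labels t x y ∧ y i = y j := fun y hy => by
        have h' := (h (Fin.snoc (α := fun _ => Bool) y (y i))).1
        simp only [labels_comp_copy, e] at h'
        simpa using h' ⟨hy, by simp⟩
      have h2 : ∀ y, Labels t x y → Labels s x y := fun y hy => by
        have h' := (h (Fin.snoc (α := fun _ => Bool) y (y j))).2
        simp only [labels_comp_copy, e] at h'
        exact (h' ⟨hy, by simp⟩).1
      rw [← ih ht fun y => ⟨fun hy => (h1 y hy).1, h2 y⟩]
      exact hs.comp_copy_eq x i j fun y hy => (h1 y hy).2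

end IsNormal

theorem eq_of_labels {n m : ℕ} {f g : mk n ⟶ mk m} (h : ∀ x y, Labels f x y ↔ Labels g x y) :
    f = g := by
  induction n generalizing m with
  | zero => exact (isNormal f).eq_of_labels (isNormal g) Fin.elim0 (h Fin.elim0)
  | succ n ih =>
    -- Bending trades an input for an output, so the induction on inputs needs arbitrary `m`.
    refine addWire_cap_injective (ih fun x y => ?_)
    simp only [labels_comp, labels_addWire, h]

theorem toHom_eq_iff {n m : ℕ} (s t : EscfmTerm n m) :
    escfmTheory.toHom s = escfmTheory.toHom t ↔ s.corelation = t.corelation := by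
  rw [EscfmTerm.corelation_eq_iff]
  exact ⟨fun h x y => iff_of_eq (congrArg (fun f : mk n ⟶ mk m => Labels f x y) h),
    fun h => eq_of_labels (f := ofTerm s) (g := ofTerm t) h⟩

end EscfmObj

/-! ### Coherence of tensor powers. -/

section Interpretation

variable {C : Type u} [Category.{v} C] [MonoidalCategory C]

/-- The identification of equal tensor powers. -/
def tensorPowCast (X : C) {n m : ℕ} (h : n = m) : tensorPow X n ⟶ tensorPow X m :=
  eqToHom (congrArg (tensorPow X) h)

theorem tensorPowCast_rfl (X : C) {n : ℕ} (h : n = n) : tensorPowCast X h = 𝟙 _ := rfl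

theorem tensorPowCast_trans (X : C) {n m p : ℕ} (h : n = m) (h' : m = p) :
    tensorPowCast X h ≫ tensorPowCast X h' = tensorPowCast X (h.trans h') := eqToHom_trans _ _

theorem tensorPowCast_succ (X : C) {n m : ℕ} (h : n = m) (h' : n + 1 = m + 1) :
    tensorPowCast X h' = tensorPowCast X h ▷ X := by
  subst h
  exact (id_whiskerRight _ _).symm

theorem tensorPowAdd_succ_hom (X : C) (n p : ℕ) : (tensorPowAdd X n (p + 1)).hom =
    (α_ (tensorPow X n) (tensorPow X p) X).inv ≫ (tensorPowAdd X n p).hom ▷ X := rfl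

theorem leftUnitor_comp_whiskerRight {P Q X : C} (e : P ⟶ Q) :
    (α_ (𝟙_ C) P X).inv ≫ ((λ_ P).hom ≫ e) ▷ X = (λ_ (P ⊗ X)).hom ≫ e ▷ X := by
  simp

theorem tensorPowAdd_zero_left (X : C) (n : ℕ) : (tensorPowAdd X 0 n).hom =
    (λ_ (tensorPow X n)).hom ≫ tensorPowCast X (Nat.zero_add n).symm := by
  induction n with
  | zero => rw [tensorPowCast_rfl, Category.comp_id]; exact unitors_equal.symm
  | succ n ih =>
    rw [tensorPowCast_succ X (Nat.zero_add n).symm, tensorPowAdd_succ_hom, ih]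
    exact leftUnitor_comp_whiskerRight _

/-- The inductive step of `tensorPowAdd_assoc`, with the tensor powers replaced by arbitrary
objects; it rests on the pentagon. -/
theorem associator_comp_whiskerRight {A B P U V S T X : C} (f : A ⊗ B ⟶ U) (g : B ⊗ P ⟶ V)
    (h : U ⊗ P ⟶ T) (k : A ⊗ V ⟶ S) (e : S ⟶ T)
    (H : f ▷ P ≫ h = (α_ A B P).hom ≫ A ◁ g ≫ k ≫ e) :
    f ▷ (P ⊗ X) ≫ (α_ U P X).inv ≫ h ▷ X =
      (α_ A B (P ⊗ X)).hom ≫ A ◁ ((α_ B P X).inv ≫ g ▷ X) ≫ ((α_ A V X).inv ≫ k ▷ X) ≫ e ▷ X := by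
  have H' := congrArg (· ▷ X) H
  simp only [comp_whiskerRight] at H'
  rw [associator_inv_naturality_left_assoc, H']
  simp

theorem tensorPowAdd_assoc (X : C) (n n' n'' : ℕ) :
    (tensorPowAdd X n n').hom ▷ tensorPow X n'' ≫ (tensorPowAdd X (n + n') n'').hom =
      (α_ _ _ _).hom ≫ tensorPow X n ◁ (tensorPowAdd X n' n'').hom ≫
        (tensorPowAdd X n (n' + n'')).hom ≫ tensorPowCast X (Nat.add_assoc n n' n'').symm := by
  induction n'' with
  | zero =>
    rw [tensorPowCast_rfl]
    change (tensorPowAdd X n n').hom ▷ 𝟙_ C ≫ (ρ_ _).hom =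
      (α_ _ _ _).hom ≫ tensorPow X n ◁ (ρ_ _).hom ≫ (tensorPowAdd X n n').hom ≫ 𝟙 _
    simp
  | succ p ih =>
    rw [tensorPowCast_succ X (Nat.add_assoc n n' p).symm]
    exact associator_comp_whiskerRight _ _ _ _ _ ih

theorem associator_inv_comp_rightUnitor (A X : C) :
    (α_ A (𝟙_ C) X).inv ≫ (ρ_ A).hom ▷ X = A ◁ (λ_ X).hom := by simp

theorem tensorPowAdd_one (X : C) (n : ℕ) :
    (tensorPowAdd X n 1).hom = tensorPow X n ◁ (λ_ X).hom :=
  associator_inv_comp_rightUnitor _ _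

theorem tensor_id_comp_whiskerLeft {A B U V : C} (f : A ⟶ B) (e : U ⟶ V) :
    (f ⊗ₘ 𝟙 U) ≫ B ◁ e = A ◁ e ≫ f ▷ V := by
  rw [tensorHom_id, whisker_exchange]

theorem tensorPowAdd_assoc' (X : C) (n n' n'' : ℕ) :
    tensorPow X n ◁ (tensorPowAdd X n' n'').hom ≫ (tensorPowAdd X n (n' + n'')).hom =
      (α_ _ _ _).inv ≫ (tensorPowAdd X n n').hom ▷ tensorPow X n'' ≫
        (tensorPowAdd X (n + n') n'').hom ≫ tensorPowCast X (Nat.add_assoc n n' n'') := by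
  rw [reassoc_of% tensorPowAdd_assoc X n n' n'']
  simp [tensorPowCast_trans, tensorPowCast_rfl]

/-- The conjugate of a tensor product by the canonical isomorphisms. -/
def tensorPowMap (X : C) {n m p q : ℕ} (f : tensorPow X n ⟶ tensorPow X m)
    (g : tensorPow X p ⟶ tensorPow X q) : tensorPow X (n + p) ⟶ tensorPow X (m + q) :=
  (tensorPowAdd X n p).inv ≫ (f ⊗ₘ g) ≫ (tensorPowAdd X m q).hom

theorem tensorPowAdd_map (X : C) {n m p q : ℕ} (f : tensorPow X n ⟶ tensorPow X m)
    (g : tensorPow X p ⟶ tensorPow X q) : (tensorPowAdd X n p).hom ≫ tensorPowMap X f g =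
      (f ⊗ₘ g) ≫ (tensorPowAdd X m q).hom := by simp [tensorPowMap]

/-- Used with `Y` the first tensor power and `e` the left unitor. Keeping `e` abstract avoids any
interaction with unitor coherence. -/
theorem conj_whiskerLeft_mul (X : C) {Y : C} (e : Y ≅ X) (f : X ⊗ X ⟶ X) :
    ((α_ Y Y X).inv ≫ (Y ◁ e.hom) ▷ X) ≫ e.hom ▷ X ▷ X ≫ (α_ X X X).hom ≫ X ◁ f ≫ e.inv ▷ X =
      (𝟙 Y ⊗ₘ (e.hom ▷ X ≫ f ≫ e.inv)) ≫ Y ◁ e.hom := by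
  have h : (Y ◁ e.hom) ▷ X ≫ e.hom ▷ X ▷ X ≫ (α_ X X X).hom =
      (α_ Y Y X).hom ≫ Y ◁ e.hom ▷ X ≫ e.hom ▷ (X ⊗ X) := by simp
  rw [Category.assoc, reassoc_of% h, ← whisker_exchange_assoc]
  simp

theorem conj_whiskerLeft_comul (X : C) {Y : C} (e : Y ≅ X) (f : X ⟶ X ⊗ X) :
    Y ◁ e.hom ≫ e.hom ▷ X ≫ X ◁ f ≫ (α_ X X X).inv ≫ e.inv ▷ X ▷ X =
      (𝟙 Y ⊗ₘ (e.hom ≫ f ≫ e.inv ▷ X)) ≫ (α_ Y Y X).inv ≫ (Y ◁ e.hom) ▷ X := by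
  have h : (α_ X X X).inv ≫ e.inv ▷ X ▷ X = e.inv ▷ (X ⊗ X) ≫ (α_ Y X X).inv := by simp
  rw [h, ← whisker_exchange_assoc]
  simp

variable [SymmetricCategory C]

theorem whiskerLeft_comp_braiding (X : C) {Y : C} (e : Y ≅ X) :
    Y ◁ e.hom ≫ e.hom ▷ X ≫ (β_ X X).hom ≫ e.inv ▷ X = (β_ Y Y).hom ≫ Y ◁ e.hom := by
  rw [← BraidedCategory.braiding_naturality_left, whisker_exchange_assoc,
    BraidedCategory.braiding_naturality_right_assoc, hom_inv_whiskerRight, Category.comp_id]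

/-- The braiding of two tensor powers. -/
def tensorPowBraid (X : C) (n m : ℕ) : tensorPow X (n + m) ⟶ tensorPow X (m + n) :=
  (tensorPowAdd X n m).inv ≫ (β_ _ _).hom ≫ (tensorPowAdd X m n).hom

theorem tensorPowAdd_braid (X : C) (n m : ℕ) : (tensorPowAdd X n m).hom ≫ tensorPowBraid X n m =
    (β_ _ _).hom ≫ (tensorPowAdd X m n).hom := by simp [tensorPowBraid]

/-- A hexagon identity transported along `tensorPowAdd`. With `n' = 1` it matches the recursion that
defines `PropTerm.braid`. -/
theorem tensorPowBraid_add_left (X : C) (n n' m : ℕ) : tensorPowBraid X (n + n') m =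
    tensorPowCast X (Nat.add_assoc n n' m) ≫
      tensorPowMap X (𝟙 (tensorPow X n)) (tensorPowBraid X n' m) ≫
      tensorPowCast X (Nat.add_assoc n m n').symm ≫
      tensorPowMap X (tensorPowBraid X n m) (𝟙 (tensorPow X n')) ≫
      tensorPowCast X (Nat.add_assoc m n n') := by
  rw [← cancel_epi (tensorPowAdd X (n + n') m).hom,
    ← cancel_epi ((tensorPowAdd X n n').hom ▷ tensorPow X m), tensorPowAdd_braid,
    BraidedCategory.braiding_naturality_left_assoc, tensorPowAdd_assoc',
    reassoc_of% tensorPowAdd_assoc X n n' m]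
  rw [reassoc_of% tensorPowCast_trans]
  simp only [tensorPowCast_rfl, Category.id_comp]
  rw [reassoc_of% tensorPowAdd_map, id_tensorHom,
    ← reassoc_of% MonoidalCategory.whiskerLeft_comp, tensorPowAdd_braid,
    MonoidalCategory.whiskerLeft_comp]
  simp only [Category.assoc]
  have h := reassoc_of% tensorPowAdd_assoc' X n m n'
  rw [h, reassoc_of% tensorPowCast_trans]
  simp only [tensorPowCast_rfl, Category.id_comp]
  rw [reassoc_of% tensorPowAdd_map, tensorHom_id,
    ← reassoc_of% comp_whiskerRight, tensorPowAdd_braid, comp_whiskerRight]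
  simp

theorem tensorPowBraid_add_right (X : C) (n m m' : ℕ) : tensorPowBraid X n (m + m') =
    tensorPowCast X (Nat.add_assoc n m m').symm ≫
      tensorPowMap X (tensorPowBraid X n m) (𝟙 (tensorPow X m')) ≫
      tensorPowCast X (Nat.add_assoc m n m') ≫
      tensorPowMap X (𝟙 (tensorPow X m)) (tensorPowBraid X n m') ≫
      tensorPowCast X (Nat.add_assoc m m' n).symm := by
  rw [← cancel_epi (tensorPowAdd X n (m + m')).hom,
    ← cancel_epi (tensorPow X n ◁ (tensorPowAdd X m m').hom), tensorPowAdd_braid,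
    BraidedCategory.braiding_naturality_right_assoc, tensorPowAdd_assoc,
    reassoc_of% tensorPowAdd_assoc' X n m m']
  rw [reassoc_of% tensorPowCast_trans]
  simp only [tensorPowCast_rfl, Category.id_comp]
  rw [reassoc_of% tensorPowAdd_map, tensorHom_id,
    ← reassoc_of% comp_whiskerRight, tensorPowAdd_braid, comp_whiskerRight]
  simp only [Category.assoc]
  have h := reassoc_of% tensorPowAdd_assoc X m n m'
  rw [h, reassoc_of% tensorPowCast_trans]
  simp only [tensorPowCast_rfl, Category.id_comp]
  rw [reassoc_of% tensorPowAdd_map, id_tensorHom,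
    ← reassoc_of% MonoidalCategory.whiskerLeft_comp, tensorPowAdd_braid,
    MonoidalCategory.whiskerLeft_comp]
  simp

/-! ### Soundness of the interpretation. -/

namespace EscfmTerm

variable (X : C) [ExtraspecialFrobenius X]

theorem interp_cast {n m n' m' : ℕ} (hn : n = n') (hm : m = m') (t : EscfmTerm n m) :
    interp X (t.cast hn hm) = tensorPowCast X hn.symm ≫ interp X t ≫ tensorPowCast X hm := by
  subst hn hm
  exact ((Category.id_comp _).trans (Category.comp_id _)).symm

theorem interp_comp {n m p : ℕ} (a : EscfmTerm n m) (b : EscfmTerm m p) :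
    interp X (.comp a b) = interp X a ≫ interp X b := rfl

theorem tensorPowAdd_interp_tensor {n m p q : ℕ} (a : EscfmTerm n m) (c : EscfmTerm p q) :
    (tensorPowAdd X n p).hom ≫ interp X (.tensor a c) =
      (interp X a ⊗ₘ interp X c) ≫ (tensorPowAdd X m q).hom := by
  simp [interp]

theorem interp_tensor_one {n m : ℕ} (a : EscfmTerm n m) :
    interp X (.tensor a .one) = (interp X a ▷ X : tensorPow X n ⊗ X ⟶ tensorPow X m ⊗ X) := by
  refine (cancel_epi (tensorPowAdd X n 1).hom).1 ?_
  rw [tensorPowAdd_interp_tensor, tensorPowAdd_one, tensorPowAdd_one]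
  exact tensor_id_comp_whiskerLeft _ _

theorem interp_idn (n : ℕ) : interp X (PropTerm.idn _ n) = 𝟙 (tensorPow X n) := by
  induction n with
  | zero => rfl
  | succ n ih =>
    refine (interp_tensor_one X _).trans ?_
    rw [ih]
    exact id_whiskerRight _ _

theorem interp_tensor {n m p q : ℕ} (a : EscfmTerm n m) (c : EscfmTerm p q) :
    interp X (.tensor a c) = tensorPowMap X (interp X a) (interp X c) := rfl

theorem interp_swap : interp X .swap = tensorPowBraid X 1 1 := by
  rw [← cancel_epi (tensorPowAdd X 1 1).hom, tensorPowAdd_braid, tensorPowAdd_one]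
  exact whiskerLeft_comp_braiding X (λ_ X)

theorem interp_one : interp X .one = 𝟙 (tensorPow X 1) := rfl

theorem interp_braidOne (m : ℕ) : interp X (PropTerm.braidOne _ m) = tensorPowBraid X 1 m := by
  induction m with
  | zero =>
    rw [← cancel_epi (tensorPowAdd X 1 0).hom, tensorPowAdd_braid, tensorPowAdd_zero_left,
      tensorPowCast_rfl, Category.comp_id]
    exact (Category.comp_id _).trans (braiding_leftUnitor _).symm
  | succ m ih =>
    refine Eq.trans ?_ (tensorPowBraid_add_right X 1 m 1).symm
    rw [PropTerm.braidOne, interp_comp, interp_tensor, interp_tensor, ih, interp_idn, interp_swap,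
      interp_one]
    simp only [tensorPowCast_rfl, Category.id_comp, Category.comp_id]

theorem interp_braid (n m : ℕ) : interp X (PropTerm.braid _ n m) = tensorPowBraid X n m := by
  induction n with
  | zero =>
    rw [← cancel_epi (tensorPowAdd X 0 m).hom, tensorPowAdd_braid, tensorPowAdd_zero_left,
      PropTerm.braid, interp_cast, interp_idn]
    have h : ((λ_ (tensorPow X m)).hom ≫ tensorPowCast X (Nat.zero_add m).symm) ≫
        tensorPowCast X (Nat.zero_add m) ≫ 𝟙 _ ≫ tensorPowCast X rfl =
        (λ_ (tensorPow X m)).hom := by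
      simp [tensorPowCast_trans, tensorPowCast_rfl]
    exact h.trans (braiding_rightUnitor _).symm
  | succ n ih =>
    rw [tensorPowBraid_add_left, PropTerm.braid, interp_comp, interp_cast, interp_tensor,
      interp_tensor, ih, interp_idn, interp_braidOne, interp_one,
      tensorPowCast_rfl X (Nat.add_assoc m n 1)]
    simp only [Category.assoc]
    exact congrArg _ (congrArg _ (congrArg _ (Category.comp_id _).symm))

theorem interp_one_tensor_mul : interp X (.tensor (p := 2) .one (.gen .mul)) =
    ((λ_ X).hom ▷ X ▷ X ≫ (α_ X X X).hom ≫ X ◁ MonObj.mul ≫ (λ_ X).inv ▷ X :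
      ((𝟙_ C ⊗ X) ⊗ X) ⊗ X ⟶ (𝟙_ C ⊗ X) ⊗ X) := by
  refine (cancel_epi (tensorPowAdd X 1 2).hom).1 ?_
  refine (tensorPowAdd_interp_tensor X .one (.gen .mul)).trans ?_
  rw [tensorPowAdd_one, tensorPowAdd_succ_hom, tensorPowAdd_one]
  exact (conj_whiskerLeft_mul X (λ_ X) _).symm

theorem interp_one_tensor_comul : interp X (.tensor (q := 2) .one (.gen .comul)) =
    ((λ_ X).hom ▷ X ≫ X ◁ ComonObj.comul ≫ (α_ X X X).inv ≫ (λ_ X).inv ▷ X ▷ X :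
      (𝟙_ C ⊗ X) ⊗ X ⟶ ((𝟙_ C ⊗ X) ⊗ X) ⊗ X) := by
  refine (cancel_epi (tensorPowAdd X 1 1).hom).1 ?_
  refine (tensorPowAdd_interp_tensor X .one (.gen .comul)).trans ?_
  rw [tensorPowAdd_one, tensorPowAdd_succ_hom, tensorPowAdd_one]
  exact (conj_whiskerLeft_comul X (λ_ X) _).symm

theorem interp_mul : interp X (.gen .mul) =
    ((λ_ X).hom ▷ X ≫ MonObj.mul ≫ (λ_ X).inv : (𝟙_ C ⊗ X) ⊗ X ⟶ 𝟙_ C ⊗ X) := rfl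

theorem interp_comul : interp X (.gen .comul) =
    ((λ_ X).hom ≫ ComonObj.comul ≫ (λ_ X).inv ▷ X : 𝟙_ C ⊗ X ⟶ (𝟙_ C ⊗ X) ⊗ X) := rfl

theorem interp_comp_eq {n m p : ℕ} {a : EscfmTerm n m} {b : EscfmTerm m p}
    {f : tensorPow X n ⟶ tensorPow X m} {g : tensorPow X m ⟶ tensorPow X p}
    (ha : interp X a = f) (hb : interp X b = g) : interp X (.comp a b) = f ≫ g := by
  rw [interp_comp, ha, hb]

section

variable {X} {Y : C} (e : Y ≅ X)

/-- The `conj` lemmas transport the equations of the monoid along `e`, in the form in which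
generators are interpreted between tensor powers; `e` is later the left unitor. -/
theorem conj_assoc : (e.hom ▷ X ≫ MonObj.mul ≫ e.inv) ▷ X ≫ e.hom ▷ X ≫ MonObj.mul ≫ e.inv =
    (e.hom ▷ X ▷ X ≫ (α_ X X X).hom ≫ X ◁ MonObj.mul ≫ e.inv ▷ X) ≫
      e.hom ▷ X ≫ MonObj.mul ≫ e.inv := by
  simp

theorem conj_comm : (e.hom ▷ X ≫ (β_ X X).hom ≫ e.inv ▷ X) ≫ e.hom ▷ X ≫ MonObj.mul ≫ e.inv =
    e.hom ▷ X ≫ MonObj.mul ≫ e.inv := by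
  have h := ExtraspecialFrobenius.mul_comm (X := X)
  rw [Category.assoc, Category.assoc, inv_hom_whiskerRight_assoc, reassoc_of% h]

theorem conj_coassoc : (e.hom ≫ ComonObj.comul ≫ e.inv ▷ X) ≫
      (e.hom ≫ ComonObj.comul ≫ e.inv ▷ X) ▷ X =
    (e.hom ≫ ComonObj.comul ≫ e.inv ▷ X) ≫
      e.hom ▷ X ≫ X ◁ ComonObj.comul ≫ (α_ X X X).inv ≫ e.inv ▷ X ▷ X := by
  simp

theorem conj_cocomm : (e.hom ≫ ComonObj.comul ≫ e.inv ▷ X) ≫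
      e.hom ▷ X ≫ (β_ X X).hom ≫ e.inv ▷ X = e.hom ≫ ComonObj.comul ≫ e.inv ▷ X := by
  have h := ExtraspecialFrobenius.comul_comm (X := X)
  simp [reassoc_of% h]

theorem conj_frobenius_left : (e.hom ≫ ComonObj.comul ≫ e.inv ▷ X) ▷ X ≫
      e.hom ▷ X ▷ X ≫ (α_ X X X).hom ≫ X ◁ MonObj.mul ≫ e.inv ▷ X =
    (e.hom ▷ X ≫ MonObj.mul ≫ e.inv) ≫ e.hom ≫ ComonObj.comul ≫ e.inv ▷ X := by
  have h := ExtraspecialFrobenius.frobenius_left (X := X)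
  simp [reassoc_of% h]

theorem conj_frobenius_right :
    (e.hom ▷ X ≫ MonObj.mul ≫ e.inv) ≫ e.hom ≫ ComonObj.comul ≫ e.inv ▷ X =
      (e.hom ▷ X ≫ X ◁ ComonObj.comul ≫ (α_ X X X).inv ≫ e.inv ▷ X ▷ X) ≫
        (e.hom ▷ X ≫ MonObj.mul ≫ e.inv) ▷ X := by
  have h := ExtraspecialFrobenius.frobenius_right (X := X)
  simp [reassoc_of% h]

theorem conj_special : (e.hom ≫ ComonObj.comul ≫ e.inv ▷ X) ≫ e.hom ▷ X ≫ MonObj.mul ≫ e.inv =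
    𝟙 Y := by
  have h := ExtraspecialFrobenius.special (X := X)
  simp [reassoc_of% h]

theorem conj_extra : (MonObj.one ≫ e.inv) ≫ e.hom ≫ ComonObj.counit = 𝟙 (𝟙_ C) := by
  simp [ExtraspecialFrobenius.extra (X := X)]

theorem conj_unital : (MonObj.one ≫ e.inv) ▷ X ≫ e.hom ▷ X ≫ MonObj.mul ≫ (λ_ X).inv =
    𝟙 (𝟙_ C ⊗ X) := by
  rw [comp_whiskerRight, Category.assoc, inv_hom_whiskerRight_assoc, MonObj.one_mul_assoc,
    Iso.hom_inv_id]

theorem conj_counital : ((λ_ X).hom ≫ ComonObj.comul ≫ e.inv ▷ X) ≫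
    (e.hom ≫ ComonObj.counit) ▷ X = 𝟙 (𝟙_ C ⊗ X) := by
  rw [comp_whiskerRight, Category.assoc, Category.assoc, inv_hom_whiskerRight_assoc,
    ComonObj.counit_comul, Iso.hom_inv_id]

end

theorem interp_eqn {n m : ℕ} {s t : EscfmTerm n m} (h : EscfmEqn s t) :
    interp X s = interp X t := by
  cases h
  case assoc =>
    exact (interp_comp_eq X (interp_tensor_one X (.gen .mul)) rfl).trans
      ((conj_assoc (λ_ X)).trans (interp_comp_eq X (interp_one_tensor_mul X) (interp_mul X)).symm)
  case unital =>
    exact (interp_comp_eq X (interp_tensor_one X (.gen .unit)) rfl).trans (conj_unital (λ_ X))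
  case comm => exact conj_comm (λ_ X)
  case coassoc =>
    exact (interp_comp_eq X rfl (interp_tensor_one X (.gen .comul))).trans
      ((conj_coassoc (λ_ X)).trans (interp_comp_eq X (interp_comul X) (interp_one_tensor_comul X)).symm)
  case counital =>
    exact (interp_comp_eq X rfl (interp_tensor_one X (.gen .counit))).trans (conj_counital (λ_ X))
  case cocomm => exact conj_cocomm (λ_ X)
  case frobenius_left =>
    exact (interp_comp_eq X (interp_tensor_one X (.gen .comul)) (interp_one_tensor_mul X)).trans
      (conj_frobenius_left (λ_ X))
  case frobenius_right =>
    exact (conj_frobenius_right (λ_ X)).trans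
      (interp_comp_eq X (interp_one_tensor_comul X) (interp_tensor_one X (.gen .mul))).symm
  case special => exact conj_special (λ_ X)
  case extra => exact conj_extra (λ_ X)

/-- Strict laws of the prop become coherence laws after precomposing with the isomorphisms
`tensorPowAdd`, which can be cancelled. -/
theorem interp_congr {n m : ℕ} {s t : EscfmTerm n m} (h : escfmTheory.Rel s t) :
    interp X s = interp X t := by
  induction h with
  | refl => rfl
  | symm _ ih => exact ih.symm
  | trans _ _ ih1 ih2 => exact ih1.trans ih2
  | comp_congr _ _ ih1 ih2 => rw [interp_comp, interp_comp, ih1, ih2]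
  | tensor_congr _ _ ih1 ih2 => simp only [interp, ih1, ih2]
  | id_comp a => rw [interp_comp, interp_idn, Category.id_comp]
  | comp_id a => rw [interp_comp, interp_idn, Category.comp_id]
  | comp_assoc a b c => simp only [interp_comp, Category.assoc]
  | tensor_id n m => simp [interp, interp_idn]
  | interchange a b a' b' => simp [interp]
  | @empty_tensor n m a =>
    rw [interp_cast, ← cancel_epi (tensorPowAdd X 0 n).hom, tensorPowAdd_interp_tensor,
      tensorPowAdd_zero_left, tensorPowAdd_zero_left]
    have h : (𝟙 (𝟙_ C) ⊗ₘ interp X a) ≫ (λ_ (tensorPow X m)).hom ≫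
        tensorPowCast X (Nat.zero_add m).symm =
        ((λ_ (tensorPow X n)).hom ≫ tensorPowCast X (Nat.zero_add n).symm) ≫
          tensorPowCast X (Nat.zero_add n) ≫ interp X a ≫
            tensorPowCast X (Nat.zero_add m).symm := by
      rw [Category.assoc, reassoc_of% tensorPowCast_trans, tensorPowCast_rfl]
      simp
    exact h
  | @tensor_empty n m a =>
    rw [← cancel_epi (tensorPowAdd X n 0).hom, tensorPowAdd_interp_tensor]
    have h : (interp X a ⊗ₘ 𝟙 (𝟙_ C)) ≫ (ρ_ (tensorPow X m)).hom =
        (ρ_ (tensorPow X n)).hom ≫ interp X a := by simp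
    exact h
  | @tensor_assoc n m n' m' n'' m'' a b c =>
    rw [interp_cast, ← cancel_epi (tensorPowAdd X _ _).hom, tensorPowAdd_interp_tensor,
      ← cancel_epi ((tensorPowAdd X _ _).hom ▷ _)]
    have h1 : (tensorPowAdd X n n').hom ▷ tensorPow X n'' ≫
        (interp X (.tensor a b) ⊗ₘ interp X c) =
        ((interp X a ⊗ₘ interp X b) ⊗ₘ interp X c) ≫
          (tensorPowAdd X m m').hom ▷ tensorPow X m'' := by
      rw [← tensorHom_id, tensorHom_comp_tensorHom, tensorPowAdd_interp_tensor, ← tensorHom_id,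
        tensorHom_comp_tensorHom, Category.id_comp, Category.comp_id]
    have h2 : tensorPow X n ◁ (tensorPowAdd X n' n'').hom ≫
        (interp X a ⊗ₘ interp X (.tensor b c)) =
        (interp X a ⊗ₘ (interp X b ⊗ₘ interp X c)) ≫
          tensorPow X m ◁ (tensorPowAdd X m' m'').hom := by
      rw [← id_tensorHom, tensorHom_comp_tensorHom, tensorPowAdd_interp_tensor, ← id_tensorHom,
        tensorHom_comp_tensorHom, Category.id_comp, Category.comp_id]
    rw [reassoc_of% h1, tensorPowAdd_assoc, reassoc_of% tensorPowAdd_assoc X n n' n'',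
      reassoc_of% tensorPowCast_trans]
    simp only [tensorPowCast_rfl, Category.id_comp]
    rw [reassoc_of% tensorPowAdd_interp_tensor, reassoc_of% h2, associator_naturality_assoc]
  | @braid_natural n m p q a c =>
    rw [interp_comp, interp_comp, interp_braid, interp_braid, ← cancel_epi (tensorPowAdd X n p).hom,
      reassoc_of% tensorPowAdd_interp_tensor, tensorPowAdd_braid, reassoc_of% tensorPowAdd_braid,
      tensorPowAdd_interp_tensor, BraidedCategory.braiding_naturality_assoc]
  | braid_symm n m =>
    rw [interp_comp, interp_braid, interp_braid, interp_idn, tensorPowBraid, tensorPowBraid]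
    simp
  | eqn h => exact interp_eqn X h

end EscfmTerm

end Interpretation

theorem mainTheorem3 {n m : ℕ} (s t : EscfmTerm n m) :
    (escfmTheory.toHom s = escfmTheory.toHom t ↔ EscfmTerm.corelation s = EscfmTerm.corelation t) ∧
    (EscfmTerm.corelation s = EscfmTerm.corelation t →
      ∀ (C : Type u) [Category.{v} C] [MonoidalCategory C] [SymmetricCategory C]
        (X : C) [ExtraspecialFrobenius X], EscfmTerm.interp X s = EscfmTerm.interp X t) :=
  ⟨EscfmObj.toHom_eq_iff s t, fun h _ _ _ _ X _ =>
    EscfmTerm.interp_congr X (Quotient.exact ((EscfmObj.toHom_eq_iff s t).2 h))⟩
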